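/- Let $(M^n,g)$ be a closed (compact, without boundary) smooth Riemannian manifold with Riemannian measure $dV$, and let $\theta$ be a smooth closed real $1$-form on $M$. Put $d_\theta\alpha=d\alpha+\theta\wedge\alpha$ on the space $\Omega^*(M)$ of smooth real differential forms, let $d^*$ and $d_\theta^*$ be the formal $L^2$ adjoints of $d$ and $d_\theta$ with respect to $g$ (zero on $0$-forms), and let $\Delta_\theta=d_\theta d_\theta^*+d_\theta^*d_\theta$. Let $X$ be the vector field dual to $\theta$, that is, $g(X,Y)=\theta(Y)$ for all $Y$. Let $0\le p\le n$ and let $\alpha\in\Omega^p(M)$ be $\Delta_\theta$-harmonic, that is, $\Delta_\theta\alpha=0$. Then $$d\alpha+\theta\wedge\alpha=0,\qquad d^*\alpha+i_X\alpha=0,$$ and $$\int_M |X|^2|\alpha|^2\,dV=\frac12\int_M \alpha\wedge[L_X,*]\alpha .$$ Here $|\alpha|^2=\langle\alpha,\alpha\rangle$ is the pointwise inner product on $p$-forms induced by $g$, $L_X$ is the Lie derivative along $X$, $*$ is the Hodge star operator of $g$, normalised by $\eta\wedge *\omega=\langle\eta,\omega\rangle\,dV$, and $[L_X,*]\alpha=L_X{*}\alpha-{*}L_X\alpha$.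 The manifold $M$ need not be orientable or connected: $*$ is taken with respect to local orientations, and $\alpha\wedge[L_X,*]\alpha=f\,dV$ with a function $f$ that does not depend on them, so that the integral on the right is $\int_M f\,dV$. -/

import Mathlib

open scoped Manifold ContDiff Nat
open MeasureTheory

noncomputable section

namespace MorseNovikov

/-! ### Exterior algebra of a vector space -/

section Algebra

variable {V : Type*} [AddCommGroup V] [Module ℝ V] [TopologicalSpace V]

/-- The multilinear map `v ↦ a (v₁, …, v_p) * b (v_{p+1}, …, v_r)`, where `r = p + q`. -/
def tensor {p q r : ℕ} (h : p + q = r) (a : V [⋀^Fin p]→L[ℝ] ℝ) (b : V [⋀^Fin q]→L[ℝ] ℝ) :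
    ContinuousMultilinearMap ℝ (fun _ : Fin r => V) ℝ where
  toFun v := a (fun i => v (Fin.cast h (Fin.castAdd q i))) *
    b (fun j => v (Fin.cast h (Fin.natAdd p j)))
  map_update_add' := by
    subst h
    intro _ v k x y
    have key : ∀ z : V, (a (fun i => Function.update v k z (Fin.castAdd q i)) *
        b (fun j => Function.update v k z (Fin.natAdd p j))) =
        Fin.addCases (motive := fun _ => ℝ)
          (fun i => a (Function.update (fun i => v (Fin.castAdd q i)) i z) *
            b (fun j => v (Fin.natAdd p j)))
          (fun j => a (fun i => v (Fin.castAdd q i)) *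
            b (Function.update (fun j => v (Fin.natAdd p j)) j z)) k := by
      intro z
      induction k using Fin.addCases with
      | left i =>
        simp only [Fin.addCases_left]
        congr 2
        · funext i₁; simp [Function.update_apply]
        · funext j₁; simp [Function.update_apply, Fin.ext_iff]; omega
      | right j =>
        simp only [Fin.addCases_right]
        congr 2
        · funext i₁; simp [Function.update_apply, Fin.ext_iff]; omega
        · funext j₁; simp [Function.update_apply]
    simp only [Fin.cast_refl, id_eq]
    have e : ‹DecidableEq (Fin (p + q))› = instDecidableEqFin (p + q) := Subsingleton.elim _ _
    subst e
    rw [key, key, key]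
    induction k using Fin.addCases with
    | left i => simp [add_mul]
    | right j => simp [mul_add]
  map_update_smul' := by
    subst h
    intro _ v k c x
    have key : ∀ z : V, (a (fun i => Function.update v k z (Fin.castAdd q i)) *
        b (fun j => Function.update v k z (Fin.natAdd p j))) =
        Fin.addCases (motive := fun _ => ℝ)
          (fun i => a (Function.update (fun i => v (Fin.castAdd q i)) i z) *
            b (fun j => v (Fin.natAdd p j)))
          (fun j => a (fun i => v (Fin.castAdd q i)) *
            b (Function.update (fun j => v (Fin.natAdd p j)) j z)) k := by
      intro z
      induction k using Fin.addCases with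
      | left i =>
        simp only [Fin.addCases_left]
        congr 2
        · funext i₁; simp [Function.update_apply]
        · funext j₁; simp [Function.update_apply, Fin.ext_iff]; omega
      | right j =>
        simp only [Fin.addCases_right]
        congr 2
        · funext i₁; simp [Function.update_apply, Fin.ext_iff]; omega
        · funext j₁; simp [Function.update_apply]
    simp only [Fin.cast_refl, id_eq]
    have e : ‹DecidableEq (Fin (p + q))› = instDecidableEqFin (p + q) := Subsingleton.elim _ _
    subst e
    rw [key, key]
    induction k using Fin.addCases with
    | left i => simp [mul_assoc]
    | right j => simp [mul_left_comm]
  cont := by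
    refine (a.cont.comp ?_).mul (b.cont.comp ?_) <;> fun_prop

/-- The wedge product `a ∧ b = (p! q!)⁻¹ ∑_σ sign(σ) (a ⊗ b) ∘ σ`, in degree `r = p + q`. -/
def wedge {p q r : ℕ} (h : p + q = r) (a : V [⋀^Fin p]→L[ℝ] ℝ) (b : V [⋀^Fin q]→L[ℝ] ℝ) :
    V [⋀^Fin r]→L[ℝ] ℝ :=
  ((p ! : ℝ) * (q ! : ℝ))⁻¹ • ContinuousMultilinearMap.alternatization (tensor h a b)

/-- The interior product `i_x w = w (x, ·, …, ·)`; it is zero on forms of degree zero. -/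
def interiorProd (x : V) : {p : ℕ} → V [⋀^Fin p]→L[ℝ] ℝ → V [⋀^Fin (p - 1)]→L[ℝ] ℝ
  | 0, _ => 0
  | _ + 1, w =>
    { w.toAlternatingMap.curryLeft x with
      cont := w.cont.comp (continuous_const.matrixVecCons continuous_id) }

end Algebra

/-! ### Riemannian linear algebra and the Lie derivative in coordinates -/

/-- The coordinate space `ℝⁿ`. -/
abbrev Coord (n : ℕ) : Type := EuclideanSpace ℝ (Fin n)

/-- The coordinate vectors `∂₁, …, ∂ₙ`. -/
def std {n : ℕ} (i : Fin n) : Coord n := EuclideanSpace.single i 1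

/-- The form `dx¹ ∧ … ∧ dxⁿ`. -/
def coordVol (n : ℕ) : (Coord n) [⋀^Fin n]→L[ℝ] ℝ :=
  { (Matrix.detRowAlternating (n := Fin n) (R := ℝ)).compLinearMap
      (EuclideanSpace.equiv (Fin n) ℝ).toLinearMap with
    cont := by
      change Continuous fun v : Fin n → Coord n => Matrix.det (Matrix.of fun i j => v i j)
      fun_prop }

/-- The form `μ (u₁, …, u_p, ·, …, ·)` obtained by filling the first `p` slots of `μ`. -/
def insertLeft {n p q : ℕ} (h : p + q = n) (μ : (Coord n) [⋀^Fin n]→L[ℝ] ℝ)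
    (u : Fin p → Coord n) : (Coord n) [⋀^Fin q]→L[ℝ] ℝ where
  toFun v := μ (fun k => Fin.append u v (Fin.cast h.symm k))
  map_update_add' := by
    subst h
    intro _ v j x y
    have key : ∀ z, (fun k => Fin.append u (Function.update v j z) (Fin.cast rfl k)) =
        Function.update (Fin.append u v) (Fin.natAdd p j) z := by
      intro z
      funext k
      induction k using Fin.addCases with
      | left i => simp [Function.update_apply, Fin.ext_iff]; omega
      | right i => simp [Function.update_apply]
    simp only [key, ContinuousAlternatingMap.map_update_add]
  map_update_smul' := by
    subst h
    intro _ v j c x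
    have key : ∀ z, (fun k => Fin.append u (Function.update v j z) (Fin.cast rfl k)) =
        Function.update (Fin.append u v) (Fin.natAdd p j) z := by
      intro z
      funext k
      induction k using Fin.addCases with
      | left i => simp [Function.update_apply, Fin.ext_iff]; omega
      | right i => simp [Function.update_apply]
    simp only [key, ContinuousAlternatingMap.map_update_smul]
  map_eq_zero_of_eq' := by
    subst h
    intro v i j hv hij
    refine μ.map_eq_zero_of_eq _ (i := Fin.natAdd p i) (j := Fin.natAdd p j) ?_ ?_
    · simpa using hv
    · simpa using hij
  cont := by
    subst h
    refine μ.cont.comp (continuous_pi fun k => ?_)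
    induction k using Fin.addCases with
    | left i => simpa using continuous_const
    | right i => simpa using continuous_apply i

/-- For an inner product with Gram matrix `G` in the coordinate basis, the induced inner product
of `p`-forms, `⟨w, η⟩ = (p!)⁻¹ G^{i₁j₁} ⋯ G^{i_pj_p} w_{i₁…i_p} η_{j₁…j_p}`. -/
def coordInner {n p : ℕ} (G : Matrix (Fin n) (Fin n) ℝ) (w η : (Coord n) [⋀^Fin p]→L[ℝ] ℝ) : ℝ :=
  (p ! : ℝ)⁻¹ * ∑ I : Fin p → Fin n, ∑ J : Fin p → Fin n,
    (∏ k, G⁻¹ (I k) (J k)) * w (fun k => std (I k)) * η (fun k => std (J k))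

/-- The volume form `√(det G) dx¹ ∧ … ∧ dxⁿ`. -/
def volForm {n : ℕ} (G : Matrix (Fin n) (Fin n) ℝ) : (Coord n) [⋀^Fin n]→L[ℝ] ℝ :=
  √G.det • coordVol n

/-- The Hodge star of a `p`-form, for the inner product with Gram matrix `G` and the orientation
of `dx¹ ∧ … ∧ dxⁿ`:
`*w = (p!)⁻¹ G^{i₁j₁} ⋯ G^{i_pj_p} w_{i₁…i_p} vol_G (∂_{j₁}, …, ∂_{j_p}, ·, …, ·)`.
It is normalised by `η ∧ *w = ⟨η, w⟩ vol_G`. -/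
def coordStar {n p q : ℕ} (h : p + q = n) (G : Matrix (Fin n) (Fin n) ℝ)
    (w : (Coord n) [⋀^Fin p]→L[ℝ] ℝ) : (Coord n) [⋀^Fin q]→L[ℝ] ℝ :=
  (p ! : ℝ)⁻¹ • ∑ I : Fin p → Fin n, ∑ J : Fin p → Fin n,
    ((∏ k, G⁻¹ (I k) (J k)) * w (fun k => std (I k))) •
      insertLeft h (volForm G) (fun k => std (J k))

/-- The Lie derivative of a form along a vector field in coordinates,
`(L_ξ w)(v₁, …, v_p) = (Dw ξ)(v₁, …, v_p) + ∑ᵢ w (v₁, …, Dξ vᵢ, …, v_p)`. -/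
def coordLie {n p : ℕ} (ξ : Coord n → Coord n) (w : Coord n → (Coord n) [⋀^Fin p]→L[ℝ] ℝ)
    (y : Coord n) : (Coord n) [⋀^Fin p]→L[ℝ] ℝ :=
  fderiv ℝ w y (ξ y) +
    (w y).fderivCompContinuousLinearMap (ContinuousLinearMap.id ℝ (Coord n)) (fderiv ℝ ξ y)

/-- The commutator `[L_ξ, *] w = L_ξ (*w) - *(L_ξ w)` in coordinates, for the Riemannian metric
with Gram matrix `G`. -/
def coordBracket {n p q : ℕ} (h : p + q = n) (G : Coord n → Matrix (Fin n) (Fin n) ℝ)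
    (ξ : Coord n → Coord n) (w : Coord n → (Coord n) [⋀^Fin p]→L[ℝ] ℝ) (y : Coord n) :
    (Coord n) [⋀^Fin q]→L[ℝ] ℝ :=
  coordLie ξ (fun z => coordStar h (G z) (w z)) y - coordStar h (G y) (coordLie ξ w y)

/-- The function `f` with `w = f vol_G`, for a form `w` of top degree. -/
def coordDensity {n : ℕ} (G : Matrix (Fin n) (Fin n) ℝ) (w : (Coord n) [⋀^Fin n]→L[ℝ] ℝ) : ℝ :=
  w std / √G.det

/-! ### Fields on a manifold -/

section Manifold

variable {n : ℕ} {M : Type*} [TopologicalSpace M] [ChartedSpace (Coord n) M]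

variable (n M) in
/-- Fields of `p`-forms on `M` (without any smoothness condition). -/
abbrev FormField (p : ℕ) : Type _ := (x : M) → (TangentSpace (𝓡 n) x) [⋀^Fin p]→L[ℝ] ℝ

variable (n M) in
/-- Vector fields on `M` (without any smoothness condition). -/
abbrev VecField : Type _ := (x : M) → TangentSpace (𝓡 n) x

variable (n M) in
/-- Smooth Riemannian metrics on `M`. -/
abbrev Metric [IsManifold (𝓡 n) ∞ M] : Type _ :=
  Bundle.ContMDiffRiemannianMetric (𝓡 n) ∞ (Coord n) (fun x : M => TangentSpace (𝓡 n) x)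

/-- The derivative at `y` of the inverse of the chart at `c`. -/
def dParam (c : M) (y : Coord n) :
    Coord n →L[ℝ] TangentSpace (𝓡 n) ((extChartAt (𝓡 n) c).symm y) :=
  mfderiv 𝓘(ℝ, Coord n) (𝓡 n) (extChartAt (𝓡 n) c).symm y

/-- The derivative at `x` of the chart at `c`. -/
def dChart (c : M) (x : M) : TangentSpace (𝓡 n) x →L[ℝ] Coord n :=
  mfderiv (𝓡 n) 𝓘(ℝ, Coord n) (extChartAt (𝓡 n) c) x

/-- A field of forms, written in the chart at `c`. -/
def formInChart {p : ℕ} (α : FormField n M p) (c : M) (y : Coord n) :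
    (Coord n) [⋀^Fin p]→L[ℝ] ℝ :=
  (α ((extChartAt (𝓡 n) c).symm y)).compContinuousLinearMap (dParam c y)

/-- A vector field, written in the chart at `c`. -/
def vecInChart (X : VecField n M) (c : M) (y : Coord n) : Coord n :=
  dChart c ((extChartAt (𝓡 n) c).symm y) (X ((extChartAt (𝓡 n) c).symm y))

/-- A field of forms is smooth if its expressions in the charts are. -/
def IsSmoothForm {p : ℕ} (α : FormField n M p) : Prop :=
  ∀ c : M, ContDiffOn ℝ ∞ (formInChart α c) (extChartAt (𝓡 n) c).target

/-- The exterior derivative, computed at `x` in the chart at `x`. -/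
def extDer {p : ℕ} (α : FormField n M p) : FormField n M (p + 1) := fun x =>
  (extDeriv (formInChart α x) (extChartAt (𝓡 n) x x)).compContinuousLinearMap (dChart x x)

/-- The operator `d_θ α = dα + θ ∧ α`. -/
def dTheta (θ : FormField n M 1) {p : ℕ} (α : FormField n M p) : FormField n M (p + 1) :=
  fun x => extDer α x + wedge (Nat.add_comm 1 p) (θ x) (α x)

/-- The field `i_X α`. -/
def interiorField (X : VecField n M) {p : ℕ} (α : FormField n M p) : FormField n M (p - 1) :=
  fun x => interiorProd (X x) (α x)

variable [IsManifold (𝓡 n) ∞ M]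

/-- The matrix `g_{ij}` of the metric in the chart at `c`. -/
def gram (g : Metric n M) (c : M) (y : Coord n) : Matrix (Fin n) (Fin n) ℝ :=
  Matrix.of fun i j =>
    g.inner ((extChartAt (𝓡 n) c).symm y) (dParam c y (std i)) (dParam c y (std j))

/-- The pointwise inner product `⟨α, β⟩` of two fields of `p`-forms. It is computed at `x` in the
chart at `x`. -/
def formInner (g : Metric n M) {p : ℕ} (α β : FormField n M p) (x : M) : ℝ :=
  coordInner (gram g x (extChartAt (𝓡 n) x x))
    (formInChart α x (extChartAt (𝓡 n) x x)) (formInChart β x (extChartAt (𝓡 n) x x))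

/-- The function `f` such that `α ∧ [L_X, *] α = f dV`. It is computed at `x` in the chart at `x`,
where both `*` and `dV` are taken for the orientation of the coordinates. The function does not
depend on that orientation, because its reversal changes the sign of `*` and of `dV`; so `M` need
not be orientable. If `M` is oriented, then `∫ α ∧ [L_X, *] α` is the integral of `f` against
the Riemannian measure. -/
def wedgeBracketDensity (g : Metric n M) (X : VecField n M) {p q : ℕ} (h : p + q = n)
    (α : FormField n M p) (x : M) : ℝ :=
  coordDensity (gram g x (extChartAt (𝓡 n) x x))
    (wedge h (formInChart α x (extChartAt (𝓡 n) x x))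
      (coordBracket h (gram g x) (vecInChart X x) (formInChart α x) (extChartAt (𝓡 n) x x)))

variable [MeasurableSpace M]

/-- The measure `√(det g_{ij}) dx¹ ⋯ dxⁿ` on the domain of the chart at `c`, extended by zero. -/
def chartVolume (g : Metric n M) (c : M) : Measure M :=
  (((volume : Measure (Coord n)).restrict (extChartAt (𝓡 n) c).target).withDensity
    fun y => ENNReal.ofReal √(gram g c y).det).map (extChartAt (𝓡 n) c).symm

/-- The Riemannian measure `dV`, which is `√(det g_{ij}) dx¹ ⋯ dxⁿ` in every chart. As these local
measures agree on overlaps, it is the least measure that dominates all of them. -/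
def riemVolume (g : Metric n M) : Measure M := ⨆ c : M, chartVolume g c

/-- The inner product `∫ ⟨α, β⟩ dV`. -/
def l2Inner (g : Metric n M) {p : ℕ} (α β : FormField n M p) : ℝ :=
  ∫ x, formInner g α β x ∂(riemVolume g)

/-- `β = D* w`, where `D*` is the formal adjoint of the operator `D` from `p`-forms to
`(p+1)`-forms: `β` is smooth, and `∫ ⟨D η, w⟩ dV = ∫ ⟨η, β⟩ dV` for all smooth `p`-forms `η`. -/
def IsAdjointValue (g : Metric n M) {p : ℕ} (D : FormField n M p → FormField n M (p + 1))
    (w : FormField n M (p + 1)) (β : FormField n M p) : Prop :=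
  IsSmoothForm β ∧ ∀ η : FormField n M p, IsSmoothForm η → l2Inner g (D η) w = l2Inner g η β

/-- `β = d* w`, with `d* w = 0` for `w` of degree zero. -/
def IsCodifferential (g : Metric n M) :
    {p : ℕ} → FormField n M p → FormField n M (p - 1) → Prop
  | 0, _, β => β = 0
  | _ + 1, w, β => IsAdjointValue g extDer w β

/-- `α` is `Δ_θ`-harmonic, `d_θ d_θ* α + d_θ* d_θ α = 0`, where `d_θ*` is the formal adjoint of
`d_θ`, with `d_θ* = 0` in degree zero. -/
def IsThetaHarmonic (g : Metric n M) (θ : FormField n M 1) :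
    {p : ℕ} → FormField n M p → Prop
  | 0, α => IsAdjointValue g (dTheta θ) (dTheta θ α) 0
  | _ + 1, α => ∃ β γ, IsAdjointValue g (dTheta θ) α β ∧
      IsAdjointValue g (dTheta θ) (dTheta θ α) γ ∧ ∀ x, dTheta θ β x + γ x = 0

end Manifold

end MorseNovikov

end

open MorseNovikov

/-!
Write `⟨⟨·, ·⟩⟩` for the `L²` inner product. The identity
`0 = ⟨⟨Δ_θ α, α⟩⟩ = ‖d_θ α‖² + ‖d_θ* α‖²` makes a harmonic form closed and coclosed for `d_θ`; since
`θ ∧ ·` is adjoint to `i_X`, this says `dα = -θ ∧ α` and `d* α = -i_X α`.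

By the Leibniz rule and the symmetry of `⟨·, ·⟩`,
`α ∧ [L_X, *] α = L_X (|α|² dV) - 2 ⟨L_X α, α⟩ dV`. The first term is the divergence of `|α|² X`,
which integrates to zero; a partition of unity reduces this to the coordinate domains, so no global
orientation is needed. For the second, Cartan's formula and the two equations for `α` give
`-⟨⟨L_X α, α⟩⟩ = ‖θ ∧ α‖² + ‖i_X α‖²`, and `|θ ∧ α|² + |i_X α|² = |X|² |α|²` pointwise because
`i_X (θ ∧ α) = |X|² α - θ ∧ i_X α`.
-/

noncomputable section

namespace MorseNovikov

/-! ### Alternating forms -/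

section AlternatingForms

variable {V W ι : Type*} [AddCommGroup V] [Module ℝ V] [TopologicalSpace V]
  [AddCommGroup W] [Module ℝ W] [TopologicalSpace W] {p q r : ℕ}

theorem sign_cast_mul_self [Fintype ι] [DecidableEq ι] (σ : Equiv.Perm ι) :
    ((Equiv.Perm.sign σ : ℤ) : ℝ) * ((Equiv.Perm.sign σ : ℤ) : ℝ) = 1 := by
  exact_mod_cast Int.units_coe_mul_self (Equiv.Perm.sign σ)

theorem form_apply_perm [Fintype ι] [DecidableEq ι] (w : V [⋀^ι]→L[ℝ] ℝ) (v : ι → V)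
    (σ : Equiv.Perm ι) :
    w (fun i => v (σ i)) = ((Equiv.Perm.sign σ : ℤ) : ℝ) * w v := by
  have h := w.toAlternatingMap.map_perm v σ
  rwa [Units.smul_def, zsmul_eq_mul] at h

theorem wedge_apply (h : p + q = r) (a : V [⋀^Fin p]→L[ℝ] ℝ) (b : V [⋀^Fin q]→L[ℝ] ℝ)
    (v : Fin r → V) :
    wedge h a b v = ((p ! : ℝ) * (q ! : ℝ))⁻¹ * ∑ σ : Equiv.Perm (Fin r),
      ((Equiv.Perm.sign σ : ℤ) : ℝ) *
        (a (fun i => v (σ (Fin.cast h (Fin.castAdd q i)))) *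
          b (fun j => v (σ (Fin.cast h (Fin.natAdd p j))))) := by
  simp only [wedge, ContinuousAlternatingMap.smul_apply, smul_eq_mul,
    ContinuousMultilinearMap.alternatization_apply_apply, Units.smul_def, zsmul_eq_mul]
  rfl

theorem wedge_compContinuousLinearMap (h : p + q = r) (a : V [⋀^Fin p]→L[ℝ] ℝ)
    (b : V [⋀^Fin q]→L[ℝ] ℝ) (f : W →L[ℝ] V) :
    wedge h (a.compContinuousLinearMap f) (b.compContinuousLinearMap f) =
      (wedge h a b).compContinuousLinearMap f := by
  ext v
  simp only [wedge_apply, ContinuousAlternatingMap.compContinuousLinearMap_apply]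
  rfl

theorem wedge_add_left (h : p + q = r) (a a' : V [⋀^Fin p]→L[ℝ] ℝ) (b : V [⋀^Fin q]→L[ℝ] ℝ) :
    wedge h (a + a') b = wedge h a b + wedge h a' b := by
  ext v
  simp only [wedge_apply, ContinuousAlternatingMap.add_apply, add_mul, mul_add,
    Finset.sum_add_distrib]

theorem wedge_add_right (h : p + q = r) (a : V [⋀^Fin p]→L[ℝ] ℝ) (b b' : V [⋀^Fin q]→L[ℝ] ℝ) :
    wedge h a (b + b') = wedge h a b + wedge h a b' := by
  ext v
  simp only [wedge_apply, ContinuousAlternatingMap.add_apply, mul_add, Finset.sum_add_distrib]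

theorem wedge_smul_left (h : p + q = r) (c : ℝ) (a : V [⋀^Fin p]→L[ℝ] ℝ)
    (b : V [⋀^Fin q]→L[ℝ] ℝ) : wedge h (c • a) b = c • wedge h a b := by
  ext v
  simp only [wedge_apply, ContinuousAlternatingMap.smul_apply, smul_eq_mul, Finset.mul_sum]
  exact Finset.sum_congr rfl fun σ _ => by ring

theorem wedge_smul_right (h : p + q = r) (c : ℝ) (a : V [⋀^Fin p]→L[ℝ] ℝ)
    (b : V [⋀^Fin q]→L[ℝ] ℝ) : wedge h a (c • b) = c • wedge h a b := by
  ext v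
  simp only [wedge_apply, ContinuousAlternatingMap.smul_apply, smul_eq_mul, Finset.mul_sum]
  exact Finset.sum_congr rfl fun σ _ => by ring

/-- The wedge product as a bilinear map. -/
def wedgeₗ (h : p + q = r) :
    V [⋀^Fin p]→L[ℝ] ℝ →ₗ[ℝ] V [⋀^Fin q]→L[ℝ] ℝ →ₗ[ℝ] V [⋀^Fin r]→L[ℝ] ℝ :=
  LinearMap.mk₂ ℝ (wedge h) (wedge_add_left h) (wedge_smul_left h) (wedge_add_right h)
    (wedge_smul_right h)

theorem sign_mul_form_apply_perm_succ (b : V [⋀^Fin p]→L[ℝ] ℝ) (v : Fin (p + 1) → V)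
    (σ : Equiv.Perm (Fin (p + 1))) :
    ((Equiv.Perm.sign σ : ℤ) : ℝ) * b (fun j => v (σ j.succ)) =
      (-1) ^ (σ 0 : ℕ) * b ((σ 0).removeNth v) := by
  -- Cycling `σ 0` to the front leaves a permutation that fixes `0`.
  obtain ⟨⟨k, τ⟩, hτ⟩ := Equiv.Perm.decomposeFin.symm.surjective ((σ 0).cycleRange * σ)
  have hk : k = 0 := by
    simpa [Equiv.Perm.decomposeFin_symm_apply_zero, Fin.cycleRange_self] using
      DFunLike.congr_fun hτ 0
  subst hk
  have hsucc (j : Fin p) : σ j.succ = (σ 0).succAbove (τ j) := by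
    have h := DFunLike.congr_fun hτ j.succ
    rw [Equiv.Perm.decomposeFin_symm_apply_succ, Equiv.swap_self, Equiv.refl_apply,
      Equiv.Perm.mul_apply, ← Equiv.symm_apply_eq, Fin.cycleRange_symm_succ] at h
    exact h.symm
  have hsign : Equiv.Perm.sign τ = (-1) ^ (σ 0 : ℕ) * Equiv.Perm.sign σ := by
    rw [← Fin.sign_cycleRange, ← Equiv.Perm.sign_mul, ← hτ]
    simp [Equiv.Perm.decomposeFin.symm_sign]
  simp only [hsucc]
  rw [form_apply_perm b (fun j => v ((σ 0).succAbove j)) τ, hsign]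
  change _ = (-1) ^ (σ 0 : ℕ) * b (fun j => v ((σ 0).succAbove j))
  push_cast
  linear_combination (-1) ^ (σ 0 : ℕ) * b (fun j => v ((σ 0).succAbove j)) * sign_cast_mul_self σ

theorem wedge_one_left_apply (a : V [⋀^Fin 1]→L[ℝ] ℝ) (b : V [⋀^Fin p]→L[ℝ] ℝ)
    (v : Fin (p + 1) → V) :
    wedge (Nat.add_comm 1 p) a b v =
      ∑ i : Fin (p + 1), (-1) ^ (i : ℕ) * (a (fun _ => v i) * b (i.removeNth v)) := by
  have hterm (σ : Equiv.Perm (Fin (p + 1))) :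
      ((Equiv.Perm.sign σ : ℤ) : ℝ) *
        (a (fun i => v (σ (Fin.cast (Nat.add_comm 1 p) (Fin.castAdd p i)))) *
          b (fun j => v (σ (Fin.cast (Nat.add_comm 1 p) (Fin.natAdd 1 j))))) =
        (-1) ^ (σ 0 : ℕ) * (a (fun _ => v (σ 0)) * b ((σ 0).removeNth v)) := by
    have hhead (i : Fin 1) : Fin.cast (Nat.add_comm 1 p) (Fin.castAdd p i) = 0 := by ext; simp
    have htail (j : Fin p) : Fin.cast (Nat.add_comm 1 p) (Fin.natAdd 1 j) = j.succ := by ext; simp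
    simp only [hhead, htail]
    linear_combination a (fun _ => v (σ 0)) * sign_mul_form_apply_perm_succ b v σ
  rw [wedge_apply, Finset.sum_congr rfl fun σ _ => hterm σ,
    ← Equiv.sum_comp Equiv.Perm.decomposeFin.symm, Fintype.sum_prod_type]
  simp only [Equiv.Perm.decomposeFin_symm_apply_zero, Finset.sum_const, Finset.card_univ,
    Fintype.card_perm, Fintype.card_fin, nsmul_eq_mul, ← Finset.mul_sum, Nat.factorial_one,
    Nat.cast_one, one_mul]
  rw [← mul_assoc, inv_mul_cancel₀ (by positivity), one_mul]

theorem interiorProd_succ_apply (x : V) (w : V [⋀^Fin (p + 1)]→L[ℝ] ℝ) (v : Fin p → V) :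
    interiorProd x w v = w (Fin.cons x v) := rfl

theorem interiorProd_zero (x : V) (w : V [⋀^Fin 0]→L[ℝ] ℝ) : interiorProd x w = 0 := rfl

theorem interiorProd_compContinuousLinearMap (f : W →L[ℝ] V) (x : W) :
    ∀ {p : ℕ} (w : V [⋀^Fin p]→L[ℝ] ℝ), interiorProd x (w.compContinuousLinearMap f) =
      (interiorProd (f x) w).compContinuousLinearMap f
  | 0, _ => by
    ext
    simp [interiorProd_zero]
  | p + 1, w => by
    ext v
    change w (f ∘ Fin.cons x v) = w (Fin.cons (f x) (f ∘ v))
    congr 1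
    funext k
    cases k using Fin.cases <;> simp

theorem interiorProd_wedge_one_zero (x : V) (a : V [⋀^Fin 1]→L[ℝ] ℝ) (b : V [⋀^Fin 0]→L[ℝ] ℝ) :
    interiorProd x (wedge (Nat.add_comm 1 0) a b) = a (fun _ => x) • b := by
  ext v
  rw [interiorProd_succ_apply, wedge_one_left_apply, Fin.sum_univ_succ, Fin.sum_univ_zero]
  simp only [Fin.val_zero, pow_zero, one_mul, add_zero, ContinuousAlternatingMap.smul_apply,
    smul_eq_mul, Fin.cons_zero]
  congr 2

theorem interiorProd_wedge_one_succ (x : V) (a : V [⋀^Fin 1]→L[ℝ] ℝ)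
    (b : V [⋀^Fin (p + 1)]→L[ℝ] ℝ) :
    interiorProd x (wedge (Nat.add_comm 1 (p + 1)) a b) =
      a (fun _ => x) • b - wedge (Nat.add_comm 1 p) a (interiorProd x b) := by
  ext v
  rw [interiorProd_succ_apply, wedge_one_left_apply, Fin.sum_univ_succ,
    ContinuousAlternatingMap.sub_apply, ContinuousAlternatingMap.smul_apply,
    wedge_one_left_apply, sub_eq_add_neg, ← Finset.sum_neg_distrib]
  congr 1
  · simp
  · refine Finset.sum_congr rfl fun i _ => ?_
    have h : i.succ.removeNth (Fin.cons x v : Fin (p + 2) → V) = Fin.cons x (i.removeNth v) := by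
      funext k
      cases k using Fin.cases <;> simp [Fin.removeNth]
    rw [h, Fin.cons_succ, interiorProd_succ_apply, Fin.val_succ, pow_succ]
    ring

end AlternatingForms

/-! ### Forms on the coordinate space -/

section CoordForms

variable {n p : ℕ}

theorem std_apply (i j : Fin n) : (std i : Coord n) j = if j = i then 1 else 0 := by
  simp [std]

theorem basisFun_toBasis_apply (i : Fin n) :
    (EuclideanSpace.basisFun (Fin n) ℝ).toBasis i = std i := by
  simp [std]

theorem sum_smul_std (v : Coord n) : ∑ i, v i • (std i : Coord n) = v := by
  ext j
  simp [std_apply]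

theorem form_apply_sum_smul_std (w : (Coord n) [⋀^Fin p]→L[ℝ] ℝ) (c : Fin p → Fin n → ℝ) :
    w (fun k => ∑ i, c k i • std i) =
      ∑ I : Fin p → Fin n, (∏ k, c k (I k)) * w (fun k => std (I k)) := by
  rw [← ContinuousAlternatingMap.coe_toContinuousMultilinearMap, ContinuousMultilinearMap.map_sum]
  refine Finset.sum_congr rfl fun I _ => ?_
  rw [ContinuousMultilinearMap.map_smul_univ, smul_eq_mul,
    ContinuousAlternatingMap.coe_toContinuousMultilinearMap]

theorem form_ext {w η : (Coord n) [⋀^Fin p]→L[ℝ] ℝ}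
    (h : ∀ I : Fin p → Fin n, w (fun k => std (I k)) = η (fun k => std (I k))) : w = η := by
  ext v
  rw [show v = fun k => ∑ i, v k i • std i from funext fun k => (sum_smul_std _).symm,
    form_apply_sum_smul_std, form_apply_sum_smul_std]
  simp only [h]

variable (n p) in
/-- The components `w (∂_{i₁}, …, ∂_{i_p})` of a form on the coordinate space. They make the
space of forms finite-dimensional and reduce its smooth maps to real functions. -/
def components : (Coord n) [⋀^Fin p]→L[ℝ] ℝ →ₗ[ℝ] ((Fin p → Fin n) → ℝ) where
  toFun w I := w (fun k => std (I k))
  map_add' _ _ := rfl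
  map_smul' _ _ := rfl

theorem components_injective : Function.Injective (components n p) := fun _ _ h =>
  form_ext fun I => congrFun h I

instance : FiniteDimensional ℝ ((Coord n) [⋀^Fin p]→L[ℝ] ℝ) :=
  Module.Finite.of_injective (components n p) components_injective

theorem contDiffOn_form_iff {E : Type*} [NormedAddCommGroup E] [NormedSpace ℝ E] {m : ℕ∞ω}
    {f : E → (Coord n) [⋀^Fin p]→L[ℝ] ℝ} {s : Set E} :
    ContDiffOn ℝ m f s ↔
      ∀ I : Fin p → Fin n, ContDiffOn ℝ m (fun y => f y fun k => std (I k)) s := by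
  constructor
  · intro h I
    exact (LinearMap.proj I ∘ₗ components n p).toContinuousLinearMap.contDiff.comp_contDiffOn h
  · intro h
    obtain ⟨L, hL⟩ := (components n p).exists_leftInverse_of_injective
      (LinearMap.ker_eq_bot.2 components_injective)
    have hcomponents : ContDiffOn ℝ m (fun y => components n p (f y)) s := contDiffOn_pi.2 h
    exact (L.toContinuousLinearMap.contDiff.comp_contDiffOn hcomponents).congr fun y _ =>
      (LinearMap.congr_fun hL (f y)).symm

theorem coordVol_apply (v : Fin n → Coord n) :
    coordVol n v = Matrix.det (Matrix.of fun i j => v i j) := rfl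

theorem coordVol_std : coordVol n std = 1 := by
  rw [coordVol_apply, ← Matrix.det_one (n := Fin n)]
  congr 1
  ext i j
  simp [std_apply, Matrix.one_apply, eq_comm]

theorem top_form_ext {w η : (Coord n) [⋀^Fin n]→L[ℝ] ℝ} (h : w std = η std) : w = η := by
  refine ContinuousAlternatingMap.toAlternatingMap_injective
    ((EuclideanSpace.basisFun (Fin n) ℝ).toBasis.ext_alternating fun I hI => ?_)
  obtain ⟨σ, rfl⟩ : ∃ σ : Equiv.Perm (Fin n), I = σ :=
    ⟨Equiv.ofBijective I (Finite.injective_iff_bijective.1 hI), rfl⟩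
  simp only [basisFun_toBasis_apply]
  exact (form_apply_perm w std σ).trans ((form_apply_perm η std σ).trans (by rw [h])).symm

theorem top_form_eq_smul_coordVol (w : (Coord n) [⋀^Fin n]→L[ℝ] ℝ) : w = w std • coordVol n :=
  top_form_ext (by simp [coordVol_std])

theorem form_eq_zero_of_lt (h : n < p) (w : (Coord n) [⋀^Fin p]→L[ℝ] ℝ) : w = 0 := by
  refine form_ext fun I => ?_
  obtain ⟨i, j, hne, hij⟩ := Fintype.exists_ne_map_eq_of_card_lt I (by simpa using h)
  exact w.map_eq_zero_of_eq _ (by rw [hij]) hne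

end CoordForms

/-! ### The inner product of forms -/

section TensorPower

open Matrix

variable {n p : ℕ}

/-- The matrix of the `p`-th tensor power of an endomorphism, in the basis of multi-indices. The
inner product of `p`-forms is given by the tensor power of the inverse Gram matrix. -/
def tensorPow (p : ℕ) (H : Matrix (Fin n) (Fin n) ℝ) :
    Matrix (Fin p → Fin n) (Fin p → Fin n) ℝ :=
  Matrix.of fun I J => ∏ k, H (I k) (J k)

theorem tensorPow_apply (H : Matrix (Fin n) (Fin n) ℝ) (I J : Fin p → Fin n) :
    tensorPow p H I J = ∏ k, H (I k) (J k) := rfl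

theorem tensorPow_mul (H K : Matrix (Fin n) (Fin n) ℝ) :
    tensorPow p (H * K) = tensorPow p H * tensorPow p K := by
  ext I J
  simp only [tensorPow_apply, Matrix.mul_apply, ← Finset.prod_mul_distrib]
  rw [Finset.prod_univ_sum, Fintype.piFinset_univ]

theorem tensorPow_one : tensorPow p (1 : Matrix (Fin n) (Fin n) ℝ) = 1 := by
  ext I J
  simp only [tensorPow_apply, Matrix.one_apply, Finset.prod_ite_zero, Finset.prod_const_one,
    Finset.mem_univ, true_implies, funext_iff]

theorem tensorPow_transpose (H : Matrix (Fin n) (Fin n) ℝ) :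
    tensorPow p Hᵀ = (tensorPow p H)ᵀ := rfl

open scoped MatrixOrder in
theorem tensorPow_posDef {H : Matrix (Fin n) (Fin n) ℝ} (hH : H.PosDef) :
    (tensorPow p H).PosDef := by
  obtain ⟨A, hA⟩ := CStarAlgebra.nonneg_iff_eq_star_mul_self.1 hH.posSemidef.nonneg
  have hsemidef : (tensorPow p H).PosSemidef := by
    rw [hA, Matrix.star_eq_conjTranspose, tensorPow_mul]
    exact Matrix.posSemidef_conjTranspose_mul_self (tensorPow p A)
  refine hsemidef.posDef_iff_isUnit.2
    (IsUnit.of_mul_eq_one (M := Matrix _ _ ℝ) (tensorPow p H⁻¹) ?_)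
  rw [← tensorPow_mul, Matrix.mul_nonsing_inv _ hH.det_pos.ne'.isUnit, tensorPow_one]

/-- The matrix of an endomorphism of the coordinate space, as for example the derivative of a
change of charts. -/
def coordMatrix (B : Coord n →L[ℝ] Coord n) : Matrix (Fin n) (Fin n) ℝ :=
  LinearMap.toMatrix (EuclideanSpace.basisFun (Fin n) ℝ).toBasis
    (EuclideanSpace.basisFun (Fin n) ℝ).toBasis B

theorem coordMatrix_apply (B : Coord n →L[ℝ] Coord n) (i j : Fin n) :
    coordMatrix B i j = B (std j) i := by
  rw [coordMatrix, LinearMap.toMatrix_apply, basisFun_toBasis_apply]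
  rfl

theorem det_coordMatrix (B : Coord n →L[ℝ] Coord n) : (coordMatrix B).det = B.det :=
  LinearMap.det_toMatrix _ _

theorem map_std_eq_sum (B : Coord n →L[ℝ] Coord n) (j : Fin n) :
    B (std j) = ∑ i, coordMatrix B i j • std i := by
  simp only [coordMatrix_apply, sum_smul_std]

theorem components_compContinuousLinearMap (w : (Coord n) [⋀^Fin p]→L[ℝ] ℝ)
    (B : Coord n →L[ℝ] Coord n) :
    components n p (w.compContinuousLinearMap B) =
      (tensorPow p (coordMatrix B))ᵀ *ᵥ components n p w := by
  ext I
  change w (fun k => B (std (I k))) = _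
  simp only [map_std_eq_sum]
  exact form_apply_sum_smul_std w fun k i => coordMatrix B i (I k)

theorem coordInner_eq_dotProduct (G : Matrix (Fin n) (Fin n) ℝ)
    (w η : (Coord n) [⋀^Fin p]→L[ℝ] ℝ) :
    coordInner G w η =
      (p ! : ℝ)⁻¹ * (components n p w ⬝ᵥ (tensorPow p G⁻¹ *ᵥ components n p η)) := by
  simp only [coordInner, dotProduct, mulVec, Finset.mul_sum]
  refine Finset.sum_congr rfl fun I _ => Finset.sum_congr rfl fun J _ => ?_
  rw [← tensorPow_apply]
  change _ = _ * (w (fun k => std (I k)) * (_ * η (fun k => std (J k))))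
  ring

theorem coordInner_add_left (G : Matrix (Fin n) (Fin n) ℝ) (w w' η : (Coord n) [⋀^Fin p]→L[ℝ] ℝ) :
    coordInner G (w + w') η = coordInner G w η + coordInner G w' η := by
  simp only [coordInner_eq_dotProduct, map_add, add_dotProduct, mul_add]

theorem coordInner_smul_left (G : Matrix (Fin n) (Fin n) ℝ) (c : ℝ)
    (w η : (Coord n) [⋀^Fin p]→L[ℝ] ℝ) : coordInner G (c • w) η = c * coordInner G w η := by
  simp only [coordInner_eq_dotProduct, map_smul, smul_dotProduct, smul_eq_mul]
  ring

theorem coordInner_comm {G : Matrix (Fin n) (Fin n) ℝ} (hG : Gᵀ = G)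
    (w η : (Coord n) [⋀^Fin p]→L[ℝ] ℝ) : coordInner G w η = coordInner G η w := by
  rw [coordInner_eq_dotProduct, coordInner_eq_dotProduct, dotProduct_comm,
    dotProduct_mulVec _ _ (components n p w), ← mulVec_transpose, ← tensorPow_transpose,
    Matrix.transpose_nonsing_inv, hG]

theorem coordInner_self_nonneg {G : Matrix (Fin n) (Fin n) ℝ} (hG : G.PosDef)
    (w : (Coord n) [⋀^Fin p]→L[ℝ] ℝ) : 0 ≤ coordInner G w w := by
  rw [coordInner_eq_dotProduct]
  exact mul_nonneg (by positivity)
    ((tensorPow_posDef hG.inv).posSemidef.dotProduct_mulVec_nonneg (components n p w))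

theorem coordInner_self_eq_zero {G : Matrix (Fin n) (Fin n) ℝ} (hG : G.PosDef)
    {w : (Coord n) [⋀^Fin p]→L[ℝ] ℝ} (h : coordInner G w w = 0) : w = 0 := by
  by_contra hw
  have hcomponents : components n p w ≠ 0 := (map_ne_zero_iff _ components_injective).2 hw
  refine ((mul_pos ?_ ((tensorPow_posDef hG.inv).dotProduct_mulVec_pos hcomponents)).ne' :
    (p ! : ℝ)⁻¹ * _ ≠ 0) ((coordInner_eq_dotProduct G w w).symm.trans h)
  positivity

theorem coordInner_compContinuousLinearMap (G : Matrix (Fin n) (Fin n) ℝ)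
    (w η : (Coord n) [⋀^Fin p]→L[ℝ] ℝ) {B : Coord n →L[ℝ] Coord n} (hB : B.det ≠ 0) :
    coordInner ((coordMatrix B)ᵀ * G * coordMatrix B)
      (w.compContinuousLinearMap B) (η.compContinuousLinearMap B) = coordInner G w η := by
  have hunit : IsUnit (coordMatrix B).det := by rwa [isUnit_iff_ne_zero, det_coordMatrix]
  have hinv : coordMatrix B * ((coordMatrix B)ᵀ * G * coordMatrix B)⁻¹ * (coordMatrix B)ᵀ =
      G⁻¹ := by
    rw [Matrix.mul_inv_rev, Matrix.mul_inv_rev, Matrix.mul_nonsing_inv_cancel_left _ _ hunit,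
      Matrix.nonsing_inv_mul_cancel_right _ _ (by rwa [Matrix.det_transpose])]
  rw [coordInner_eq_dotProduct, coordInner_eq_dotProduct, components_compContinuousLinearMap,
    components_compContinuousLinearMap, mulVec_transpose, ← dotProduct_mulVec, mulVec_mulVec,
    mulVec_mulVec, ← tensorPow_transpose, ← tensorPow_mul, ← tensorPow_mul, hinv]

theorem coordInner_alternatization (G : Matrix (Fin n) (Fin n) ℝ)
    (f : ContinuousMultilinearMap ℝ (fun _ : Fin p => Coord n) ℝ)
    (w : (Coord n) [⋀^Fin p]→L[ℝ] ℝ) :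
    coordInner G (ContinuousMultilinearMap.alternatization f) w =
      ∑ I : Fin p → Fin n, ∑ J : Fin p → Fin n,
        tensorPow p G⁻¹ I J * f (fun k => std (I k)) * w (fun k => std (J k)) := by
  have hperm (σ : Equiv.Perm (Fin p)) : ∑ I : Fin p → Fin n, ∑ J : Fin p → Fin n,
      tensorPow p G⁻¹ I J * (((Equiv.Perm.sign σ : ℤ) : ℝ) * f (fun k => std (I (σ k)))) *
        w (fun k => std (J k)) = ∑ I : Fin p → Fin n, ∑ J : Fin p → Fin n,
      tensorPow p G⁻¹ I J * f (fun k => std (I k)) * w (fun k => std (J k)) := by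
    rw [← Equiv.sum_comp (σ.arrowCongr (Equiv.refl (Fin n)))]
    refine Finset.sum_congr rfl fun I _ => ?_
    rw [← Equiv.sum_comp (σ.arrowCongr (Equiv.refl (Fin n)))]
    refine Finset.sum_congr rfl fun J _ => ?_
    have hw := form_apply_perm w (fun k => std (J (σ.symm k))) σ
    simp only [Equiv.symm_apply_apply] at hw
    simp only [tensorPow_apply, Equiv.arrowCongr_apply, Function.comp_apply, Equiv.refl_apply,
      Equiv.symm_apply_apply, hw, Equiv.prod_comp σ.symm fun k => G⁻¹ (I k) (J k)]
    ring
  have hsum : ∑ I : Fin p → Fin n, ∑ J : Fin p → Fin n, tensorPow p G⁻¹ I J *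
      ContinuousMultilinearMap.alternatization f (fun k => std (I k)) * w (fun k => std (J k)) =
      p ! * ∑ I : Fin p → Fin n, ∑ J : Fin p → Fin n,
        tensorPow p G⁻¹ I J * f (fun k => std (I k)) * w (fun k => std (J k)) := by
    simp only [ContinuousMultilinearMap.alternatization_apply_apply, Units.smul_def,
      zsmul_eq_mul, Finset.mul_sum, Finset.sum_mul]
    rw [Finset.sum_congr rfl fun I _ => Finset.sum_comm, Finset.sum_comm]
    refine (Finset.sum_congr rfl fun σ _ => hperm σ).trans ?_
    rw [Finset.sum_const, Finset.card_univ, Fintype.card_perm, Fintype.card_fin, nsmul_eq_mul]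
    simp only [Finset.mul_sum]
  exact (congrArg ((p ! : ℝ)⁻¹ * ·) hsum).trans (inv_mul_cancel_left₀ (by positivity) _)

theorem interiorProd_eq_sum (x : Coord n) (w : (Coord n) [⋀^Fin (p + 1)]→L[ℝ] ℝ)
    (v : Fin p → Coord n) :
    interiorProd x w v = ∑ i, x i * w (Fin.cons (std i) v) := by
  calc interiorProd x w v = w.curryLeft (∑ i, x i • std i) v := by rw [sum_smul_std]; rfl
    _ = ∑ i, x i * w (Fin.cons (std i) v) := by
      simp only [map_sum, map_smul, ContinuousAlternatingMap.sum_apply,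
        ContinuousAlternatingMap.smul_apply, smul_eq_mul]
      rfl

theorem sum_tensorPow_succ (H : Matrix (Fin n) (Fin n) ℝ)
    (F : (Fin (p + 1) → Fin n) → (Fin (p + 1) → Fin n) → ℝ) :
    ∑ I, ∑ J, tensorPow (p + 1) H I J * F I J =
      ∑ I : Fin p → Fin n, ∑ J : Fin p → Fin n, tensorPow p H I J *
        ∑ j, ∑ i, H i j * F (Fin.cons i I) (Fin.cons j J) := by
  have hsplit (f : (Fin (p + 1) → Fin n) → ℝ) :
      ∑ I, f I = ∑ I : Fin p → Fin n, ∑ i, f (Fin.cons i I) := by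
    rw [← Equiv.sum_comp (Fin.consEquiv fun _ => Fin n), Fintype.sum_prod_type_right]
    rfl
  simp only [hsplit, tensorPow_apply, Fin.prod_univ_succ, Fin.cons_zero, Fin.cons_succ,
    Finset.mul_sum]
  refine Finset.sum_congr rfl fun I _ => ?_
  rw [Finset.sum_comm]
  refine Finset.sum_congr rfl fun J _ => ?_
  rw [Finset.sum_comm]
  exact Finset.sum_congr rfl fun j _ => Finset.sum_congr rfl fun i _ => by ring

theorem coordInner_wedge_one (G : Matrix (Fin n) (Fin n) ℝ) (a : (Coord n) [⋀^Fin 1]→L[ℝ] ℝ)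
    (η : (Coord n) [⋀^Fin p]→L[ℝ] ℝ) (w : (Coord n) [⋀^Fin (p + 1)]→L[ℝ] ℝ) (x : Coord n)
    (hx : ∀ j, x j = ∑ i, G⁻¹ i j * a (fun _ => std i)) :
    coordInner G (wedge (Nat.add_comm 1 p) a η) w = coordInner G η (w.curryLeft x) := by
  have htensor (I : Fin (p + 1) → Fin n) :
      tensor (Nat.add_comm 1 p) a η (fun k => std (I k)) =
        a (fun _ => std (I 0)) * η (fun k => std (I k.succ)) := by
    change a (fun i => std (I (Fin.cast _ (Fin.castAdd p i)))) *
      η (fun k => std (I (Fin.cast _ (Fin.natAdd 1 k)))) = _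
    congr 2
    · funext i
      congr 2
      ext
      simp
    · funext k
      congr 2
      ext
      simp
  have hcons (j : Fin n) (J : Fin p → Fin n) :
      (fun k => std ((Fin.cons j J : Fin (p + 1) → Fin n) k) : Fin (p + 1) → Coord n) =
        Fin.cons (std j) fun k => std (J k) := by
    funext k
    cases k using Fin.cases <;> rfl
  rw [wedge, coordInner_smul_left, coordInner_alternatization, coordInner, Nat.factorial_one,
    Nat.cast_one, one_mul]
  simp only [htensor, mul_assoc, sum_tensorPow_succ, Fin.cons_zero, Fin.cons_succ, hcons]
  congr 1
  refine Finset.sum_congr rfl fun I _ => Finset.sum_congr rfl fun J _ => ?_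
  have hinterior := interiorProd_eq_sum x w fun k => std (J k)
  simp only [hx, Finset.sum_mul] at hinterior
  rw [tensorPow_apply]
  refine congrArg ((∏ k, G⁻¹ (I k) (J k)) * ·) (Eq.trans ?_
    (congrArg (η (fun k => std (I k)) * ·) hinterior.symm))
  simp only [Finset.mul_sum]
  exact Finset.sum_congr rfl fun j _ => Finset.sum_congr rfl fun i _ => by ring

end TensorPower

/-! ### The Hodge star -/

section HodgeStar

variable {n p q : ℕ}

/-- The permutation of `p + q` letters that acts by `ρ` on the first `p` letters and by `τ` on
the last `q` letters. In the sum defining `η ∧ *w` only these permutations contribute. -/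
def blockPerm (ρ : Equiv.Perm (Fin p)) (τ : Equiv.Perm (Fin q)) : Equiv.Perm (Fin (p + q)) :=
  finSumFinEquiv.permCongr (Equiv.Perm.sumCongr ρ τ)

theorem blockPerm_castAdd (ρ : Equiv.Perm (Fin p)) (τ : Equiv.Perm (Fin q)) (i : Fin p) :
    blockPerm ρ τ (Fin.castAdd q i) = Fin.castAdd q (ρ i) := by
  simp [blockPerm]

theorem blockPerm_natAdd (ρ : Equiv.Perm (Fin p)) (τ : Equiv.Perm (Fin q)) (j : Fin q) :
    blockPerm ρ τ (Fin.natAdd p j) = Fin.natAdd p (τ j) := by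
  simp [blockPerm]

theorem sign_blockPerm (ρ : Equiv.Perm (Fin p)) (τ : Equiv.Perm (Fin q)) :
    Equiv.Perm.sign (blockPerm ρ τ) = Equiv.Perm.sign ρ * Equiv.Perm.sign τ := by
  rw [blockPerm, Equiv.Perm.sign_permCongr, Equiv.Perm.sign_sumCongr]

theorem exists_blockPerm_eq {σ : Equiv.Perm (Fin (p + q))}
    (h : ∀ i j, σ (Fin.natAdd p j) ≠ Fin.castAdd q i) : ∃ ρ τ, blockPerm ρ τ = σ := by
  have hright : Set.MapsTo (finSumFinEquiv.symm.permCongr σ)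
      (Set.range Sum.inr) (Set.range Sum.inr) := by
    rintro _ ⟨j, rfl⟩
    cases hk : σ (Fin.natAdd p j) using Fin.addCases with
    | left i => exact absurd hk (h i j)
    | right j' => exact ⟨j', by simp [Equiv.permCongr_apply, hk]⟩
  obtain ⟨⟨ρ, τ⟩, hρτ⟩ := Equiv.Perm.mem_sumCongrHom_range_of_perm_mapsTo_inl
    ((Equiv.Perm.perm_mapsTo_inl_iff_mapsTo_inr _).2 hright)
  refine ⟨ρ, τ, ?_⟩
  rw [blockPerm, ← finSumFinEquiv.permCongr.eq_symm_apply]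
  exact hρτ

theorem sum_perm_eq_sum_blockPerm {f : Equiv.Perm (Fin (p + q)) → ℝ}
    (hf : ∀ σ i j, σ (Fin.natAdd p j) = Fin.castAdd q i → f σ = 0) :
    ∑ σ, f σ = ∑ x : Equiv.Perm (Fin p) × Equiv.Perm (Fin q), f (blockPerm x.1 x.2) := by
  refine (Fintype.sum_of_injective (fun x : Equiv.Perm (Fin p) × Equiv.Perm (Fin q) =>
    blockPerm x.1 x.2) (fun x y hxy => ?_) _ _ (fun σ hσ => ?_) fun _ => rfl).symm
  · exact Equiv.Perm.sumCongrHom_injective (finSumFinEquiv.permCongr.injective hxy)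
  · by_contra hne
    obtain ⟨ρ, τ, rfl⟩ := exists_blockPerm_eq fun i j hij => hne (hf σ i j hij)
    exact hσ ⟨(ρ, τ), rfl⟩

theorem insertLeft_apply (μ : (Coord (p + q)) [⋀^Fin (p + q)]→L[ℝ] ℝ) (u : Fin p → Coord (p + q))
    (v : Fin q → Coord (p + q)) : insertLeft rfl μ u v = μ (Fin.append u v) := rfl

theorem insertLeft_smul (h : p + q = n) (c : ℝ) (μ : (Coord n) [⋀^Fin n]→L[ℝ] ℝ)
    (u : Fin p → Coord n) : insertLeft h (c • μ) u = c • insertLeft h μ u := rfl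

theorem form_apply_append_blockPerm (μ : (Coord n) [⋀^Fin (p + q)]→L[ℝ] ℝ)
    (v : Fin (p + q) → Coord n) (τ : Equiv.Perm (Fin q)) :
    μ (Fin.append (fun i => v (Fin.castAdd q i)) fun j => v (Fin.natAdd p (τ j))) =
      ((Equiv.Perm.sign τ : ℤ) : ℝ) * μ v := by
  have hperm := form_apply_perm μ v (blockPerm 1 τ)
  rw [sign_blockPerm, map_one, one_mul] at hperm
  rw [← hperm]
  congr 1
  funext k
  cases k using Fin.addCases <;> simp [blockPerm_castAdd, blockPerm_natAdd]

theorem wedge_insertLeft_apply (η : (Coord (p + q)) [⋀^Fin p]→L[ℝ] ℝ)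
    (μ : (Coord (p + q)) [⋀^Fin (p + q)]→L[ℝ] ℝ) (v : Fin (p + q) → Coord (p + q)) :
    wedge rfl η (insertLeft rfl μ fun i => v (Fin.castAdd q i)) v =
      η (fun i => v (Fin.castAdd q i)) * μ v := by
  have hmixed (σ : Equiv.Perm (Fin (p + q))) (i : Fin p) (j : Fin q)
      (hij : σ (Fin.natAdd p j) = Fin.castAdd q i) :
      μ (Fin.append (fun i => v (Fin.castAdd q i)) fun j => v (σ (Fin.natAdd p j))) = 0 := by
    refine μ.map_eq_zero_of_eq _ (i := Fin.castAdd q i) (j := Fin.natAdd p j) ?_ ?_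
    · simp [hij]
    · simp only [ne_eq, Fin.ext_iff, Fin.val_castAdd, Fin.val_natAdd]
      omega
  have hblock (ρ : Equiv.Perm (Fin p)) (τ : Equiv.Perm (Fin q)) :
      ((Equiv.Perm.sign (blockPerm ρ τ) : ℤ) : ℝ) *
        (η (fun i => v (Fin.castAdd q (ρ i))) *
          μ (Fin.append (fun i => v (Fin.castAdd q i)) fun j => v (Fin.natAdd p (τ j)))) =
        η (fun i => v (Fin.castAdd q i)) * μ v := by
    rw [form_apply_perm η (fun i => v (Fin.castAdd q i)), form_apply_append_blockPerm,
      sign_blockPerm]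
    push_cast
    linear_combination η (fun i => v (Fin.castAdd q i)) * μ v *
      (sign_cast_mul_self τ + ((Equiv.Perm.sign τ : ℤ) : ℝ) ^ 2 * sign_cast_mul_self ρ)
  simp only [wedge_apply, insertLeft_apply, Fin.cast_refl, id]
  rw [sum_perm_eq_sum_blockPerm fun σ i j hij => by rw [hmixed σ i j hij, mul_zero, mul_zero]]
  simp only [blockPerm_castAdd, blockPerm_natAdd, hblock, Finset.sum_const, Finset.card_univ,
    Fintype.card_prod, Fintype.card_perm, Fintype.card_fin, nsmul_eq_mul, Nat.cast_mul]
  exact inv_mul_cancel_left₀ (by positivity) _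

theorem wedge_insertLeft (h : p + q = n) (η : (Coord n) [⋀^Fin p]→L[ℝ] ℝ)
    (μ : (Coord n) [⋀^Fin n]→L[ℝ] ℝ) (J : Fin p → Fin n) :
    wedge h η (insertLeft h μ fun k => std (J k)) = η (fun k => std (J k)) • μ := by
  subst h
  by_cases hJ : Function.Injective J
  · obtain ⟨σ, hσ⟩ := Equiv.Perm.exists_extending_pair _ J (Fin.castAdd_injective p q) hJ
    have happly := wedge_insertLeft_apply η μ fun k => std (σ k)
    simp only [hσ] at happly
    refine top_form_ext ?_
    rw [form_apply_perm, form_apply_perm μ, mul_left_comm] at happly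
    exact mul_left_cancel₀ (by exact_mod_cast (Equiv.Perm.sign σ).ne_zero) happly
  · simp only [Function.Injective, not_forall] at hJ
    obtain ⟨i, j, hij, hne⟩ := hJ
    have hinsert : (insertLeft rfl μ fun k => std (J k)) =
        (0 : (Coord (p + q)) [⋀^Fin q]→L[ℝ] ℝ) := by
      ext v
      exact μ.map_eq_zero_of_eq _ (i := Fin.castAdd q i) (j := Fin.castAdd q j) (by simp [hij])
        (by simpa using hne)
    rw [η.map_eq_zero_of_eq _ (by rw [hij]) hne, zero_smul, hinsert]
    exact map_zero (wedgeₗ rfl η)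

theorem wedge_coordStar (h : p + q = n) (G : Matrix (Fin n) (Fin n) ℝ)
    (η w : (Coord n) [⋀^Fin p]→L[ℝ] ℝ) :
    wedge h η (coordStar h G w) = coordInner G w η • volForm G := by
  change wedgeₗ h η (coordStar h G w) = _
  simp only [coordStar, map_smul, map_sum]
  simp only [wedgeₗ, LinearMap.mk₂_apply, wedge_insertLeft, smul_smul, ← Finset.sum_smul]
  rfl

end HodgeStar

/-! ### Change of coordinates -/

section ChangeOfCoordinates

variable {n : ℕ}

theorem top_form_compContinuousLinearMap (w : (Coord n) [⋀^Fin n]→L[ℝ] ℝ)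
    (B : Coord n →L[ℝ] Coord n) : w.compContinuousLinearMap B = B.det • w := by
  have hvol : (coordVol n).compContinuousLinearMap B std = B.det := by
    rw [← det_coordMatrix, ← Matrix.det_transpose]
    exact congrArg Matrix.det (Matrix.ext fun i j => (coordMatrix_apply B j i).symm)
  refine top_form_ext ?_
  rw [top_form_eq_smul_coordVol w, ContinuousAlternatingMap.smul_apply,
    ContinuousAlternatingMap.smul_apply, coordVol_std]
  change w std * (coordVol n).compContinuousLinearMap B std = B.det * (w std * 1)
  rw [hvol]
  ring

theorem sqrt_det_transpose_mul_mul (G : Matrix (Fin n) (Fin n) ℝ) (B : Coord n →L[ℝ] Coord n) :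
    √((coordMatrix B).transpose * G * coordMatrix B).det = |B.det| * √G.det := by
  rw [Matrix.det_mul, Matrix.det_mul, Matrix.det_transpose, det_coordMatrix,
    show B.det * G.det * B.det = B.det ^ 2 * G.det by ring, Real.sqrt_mul (sq_nonneg _),
    Real.sqrt_sq_eq_abs]

end ChangeOfCoordinates

section Calculus

variable {n p q r : ℕ}

/-! ### Differentiability of the algebraic operations -/

section Smoothness

variable {E : Type*} [NormedAddCommGroup E] [NormedSpace ℝ E] {m : ℕ∞ω} {s : Set E}

theorem contDiffOn_wedge (h : p + q = r) {a : E → (Coord n) [⋀^Fin p]→L[ℝ] ℝ}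
    {b : E → (Coord n) [⋀^Fin q]→L[ℝ] ℝ} (ha : ContDiffOn ℝ m a s) (hb : ContDiffOn ℝ m b s) :
    ContDiffOn ℝ m (fun y => wedge h (a y) (b y)) s := by
  let B := (wedgeₗ (V := Coord n) h).toContinuousBilinearMap
  have hB : ∀ y, wedge h (a y) (b y) = B (a y) (b y) := fun y => rfl
  simp only [hB]
  exact (B.contDiff.comp_contDiffOn ha).clm_apply hb

variable (n p) in
/-- The interior product as a bilinear map. -/
def interiorProdₗ :
    Coord n →ₗ[ℝ] (Coord n) [⋀^Fin p]→L[ℝ] ℝ →ₗ[ℝ] (Coord n) [⋀^Fin (p - 1)]→L[ℝ] ℝ :=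
  match p with
  | 0 => 0
  | p + 1 => LinearMap.mk₂ ℝ (fun x w => w.curryLeft x) (fun x y w => by simp)
    (fun c x w => by simp) (fun x w η => rfl) (fun c x w => rfl)

theorem interiorProdₗ_apply (x : Coord n) (w : (Coord n) [⋀^Fin p]→L[ℝ] ℝ) :
    interiorProdₗ n p x w = interiorProd x w := by
  cases p <;> rfl

theorem contDiffOn_interiorProd {ξ : E → Coord n} {w : E → (Coord n) [⋀^Fin p]→L[ℝ] ℝ}
    (hξ : ContDiffOn ℝ m ξ s) (hw : ContDiffOn ℝ m w s) :
    ContDiffOn ℝ m (fun y => interiorProd (ξ y) (w y)) s := by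
  simp only [← interiorProdₗ_apply]
  let B := (interiorProdₗ n p).toContinuousBilinearMap
  exact (B.contDiff.comp_contDiffOn hξ).clm_apply hw

theorem contDiffOn_det {G : E → Matrix (Fin n) (Fin n) ℝ}
    (hG : ∀ i j, ContDiffOn ℝ m (fun y => G y i j) s) : ContDiffOn ℝ m (fun y => (G y).det) s := by
  simp only [Matrix.det_apply]
  exact ContDiffOn.sum fun σ _ => (contDiffOn_prod fun i _ => hG _ _).const_smul _

variable {G : E → Matrix (Fin n) (Fin n) ℝ} (hG : ∀ i j, ContDiffOn ℝ m (fun y => G y i j) s)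
  (hpos : ∀ y ∈ s, (G y).PosDef)

include hG hpos

theorem contDiffOn_inv_apply (i j : Fin n) : ContDiffOn ℝ m (fun y => (G y)⁻¹ i j) s := by
  simp only [Matrix.inv_def, Matrix.smul_apply, smul_eq_mul, Ring.inverse_eq_inv',
    Matrix.adjugate_apply]
  refine ((contDiffOn_det hG).inv fun y hy => (hpos y hy).det_pos.ne').mul (contDiffOn_det ?_)
  intro k l
  by_cases hk : k = j
  · subst hk
    simp only [Matrix.updateRow_self]
    exact contDiffOn_const
  · simp only [Matrix.updateRow_ne hk]
    exact hG k l

theorem contDiffOn_sqrt_det : ContDiffOn ℝ m (fun y => √(G y).det) s :=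
  (contDiffOn_det hG).sqrt fun y hy => (hpos y hy).det_pos.ne'

theorem contDiffOn_volForm : ContDiffOn ℝ m (fun y => volForm (G y)) s :=
  (contDiffOn_sqrt_det hG hpos).smul contDiffOn_const

theorem contDiffOn_coordInner {w η : E → (Coord n) [⋀^Fin p]→L[ℝ] ℝ} (hw : ContDiffOn ℝ m w s)
    (hη : ContDiffOn ℝ m η s) : ContDiffOn ℝ m (fun y => coordInner (G y) (w y) (η y)) s := by
  rw [contDiffOn_form_iff] at hw hη
  exact contDiffOn_const.mul (ContDiffOn.sum fun I _ => ContDiffOn.sum fun J _ =>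
    ((contDiffOn_prod fun k _ => contDiffOn_inv_apply hG hpos _ _).mul (hw I)).mul (hη J))

theorem contDiffOn_coordStar (h : p + q = n) {w : E → (Coord n) [⋀^Fin p]→L[ℝ] ℝ}
    (hw : ContDiffOn ℝ m w s) : ContDiffOn ℝ m (fun y => coordStar h (G y) (w y)) s := by
  rw [contDiffOn_form_iff] at hw
  refine ContDiffOn.const_smul _ (ContDiffOn.sum fun I _ => ContDiffOn.sum fun J _ =>
    ((contDiffOn_prod fun k _ => contDiffOn_inv_apply hG hpos _ _).mul (hw I)).smul ?_)
  simp only [volForm, insertLeft_smul]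
  exact (contDiffOn_sqrt_det hG hpos).smul contDiffOn_const

end Smoothness

/-! ### The Lie derivative -/

theorem compContinuousLinearMap_id (w : (Coord n) [⋀^Fin p]→L[ℝ] ℝ) :
    w.compContinuousLinearMap (ContinuousLinearMap.id ℝ (Coord n)) = w := rfl

theorem id_add_zero_smul (A : Coord n →L[ℝ] Coord n) :
    ContinuousLinearMap.id ℝ (Coord n) + (0 : ℝ) • A = ContinuousLinearMap.id ℝ (Coord n) := by
  ext v
  simp

theorem coordLie_of_subsingleton [Subsingleton (Coord n)] (ξ : Coord n → Coord n)
    (w : Coord n → (Coord n) [⋀^Fin p]→L[ℝ] ℝ) (y : Coord n) : coordLie ξ w y = 0 := by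
  rw [coordLie, Subsingleton.elim (ξ y) 0, Subsingleton.elim (fderiv ℝ ξ y) 0, map_zero, map_zero,
    add_zero]

section LieDerivative

variable {ξ : Coord n → Coord n} {y : Coord n}

/-- The map `z ↦ z + t • ξ z` agrees with the flow of `ξ` to first order in `t`. -/
theorem hasDerivAt_coordLie {w : Coord n → (Coord n) [⋀^Fin p]→L[ℝ] ℝ}
    (hw : DifferentiableAt ℝ w y) :
    HasDerivAt (fun t : ℝ => (w (y + t • ξ y)).compContinuousLinearMap
      (ContinuousLinearMap.id ℝ (Coord n) + t • fderiv ℝ ξ y)) (coordLie ξ w y) 0 := by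
  have hpoint : HasDerivAt (fun t : ℝ => y + t • ξ y) (ξ y) 0 := by
    simpa using ((hasDerivAt_id (0 : ℝ)).smul_const (ξ y)).const_add y
  have hframe : HasDerivAt (fun t : ℝ => ContinuousLinearMap.id ℝ (Coord n) + t • fderiv ℝ ξ y)
      (fderiv ℝ ξ y) 0 := by
    simpa using ((hasDerivAt_id (0 : ℝ)).smul_const (fderiv ℝ ξ y)).const_add
      (ContinuousLinearMap.id ℝ (Coord n))
  have hform : HasDerivAt (fun t : ℝ => w (y + t • ξ y)) (fderiv ℝ w y (ξ y)) 0 := by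
    refine HasFDerivAt.comp_hasDerivAt (0 : ℝ) ?_ hpoint
    simpa using hw.hasFDerivAt
  refine (hform.hasFDerivAt.continuousAlternatingMapCompContinuousLinearMap
    hframe.hasFDerivAt).hasDerivAt.congr_deriv ?_
  rw [id_add_zero_smul]
  simp [coordLie, compContinuousLinearMap_id]

theorem coordLie_wedge (h : p + q = r) {a : Coord n → (Coord n) [⋀^Fin p]→L[ℝ] ℝ}
    {b : Coord n → (Coord n) [⋀^Fin q]→L[ℝ] ℝ} (ha : DifferentiableAt ℝ a y)
    (hb : DifferentiableAt ℝ b y) :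
    coordLie ξ (fun z => wedge h (a z) (b z)) y =
      wedge h (coordLie ξ a y) (b y) + wedge h (a y) (coordLie ξ b y) := by
  let B := (wedgeₗ (V := Coord n) h).toContinuousBilinearMap
  have hab : DifferentiableAt ℝ (fun z => wedge h (a z) (b z)) y :=
    (B.hasFDerivAt_of_bilinear ha.hasFDerivAt hb.hasFDerivAt).differentiableAt
  have hpull := hasDerivAt_coordLie (ξ := ξ) hab
  simp only [← wedge_compContinuousLinearMap] at hpull
  have hleibniz := (B.hasFDerivAt_of_bilinear (hasDerivAt_coordLie (ξ := ξ) ha).hasFDerivAt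
    (hasDerivAt_coordLie (ξ := ξ) hb).hasFDerivAt).hasDerivAt
  rw [hpull.unique hleibniz, add_comm, id_add_zero_smul]
  simp [B, wedgeₗ, compContinuousLinearMap_id]

theorem extDeriv_apply_cons (x : Coord n) (w : Coord n → (Coord n) [⋀^Fin (p + 1)]→L[ℝ] ℝ)
    (v : Fin (p + 1) → Coord n) :
    extDeriv w y (Fin.cons x v) = fderiv ℝ w y x v -
      ∑ i : Fin (p + 1), (-1) ^ (i : ℕ) * fderiv ℝ w y (v i) (Fin.cons x (i.removeNth v)) := by
  have hremove : ∀ i : Fin (p + 1),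
      i.succ.removeNth (Fin.cons x v : Fin (p + 2) → Coord n) = Fin.cons x (i.removeNth v) := by
    intro i
    funext k
    cases k using Fin.cases <;> simp [Fin.removeNth]
  rw [extDeriv, ContinuousAlternatingMap.alternatizeUncurryFin_apply, Fin.sum_univ_succ,
    sub_eq_add_neg, ← Finset.sum_neg_distrib]
  congr 1
  · simp
  · refine Finset.sum_congr rfl fun i _ => ?_
    rw [hremove, Fin.cons_succ, Fin.val_succ, pow_succ, zsmul_eq_mul]
    push_cast
    ring

section SuccDegree

variable {w : Coord n → (Coord n) [⋀^Fin (p + 1)]→L[ℝ] ℝ}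

theorem extDeriv_curryLeft_apply (hξ : DifferentiableAt ℝ ξ y) (hw : DifferentiableAt ℝ w y)
    (v : Fin (p + 1) → Coord n) :
    extDeriv (fun z => (w z).curryLeft (ξ z)) y v =
      ∑ i : Fin (p + 1), (-1) ^ (i : ℕ) * (fderiv ℝ w y (v i) (Fin.cons (ξ y) (i.removeNth v)) +
        w y (Fin.cons (fderiv ℝ ξ y (v i)) (i.removeNth v))) := by
  let B : Coord n →L[ℝ] (Coord n) [⋀^Fin (p + 1)]→L[ℝ] ℝ →L[ℝ] (Coord n) [⋀^Fin p]→L[ℝ] ℝ :=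
    (interiorProdₗ n (p + 1)).toContinuousBilinearMap
  have hB : HasFDerivAt (fun z => (w z).curryLeft (ξ z)) _ y :=
    B.hasFDerivAt_of_bilinear hξ.hasFDerivAt hw.hasFDerivAt
  rw [extDeriv, hB.fderiv, ContinuousAlternatingMap.alternatizeUncurryFin_apply]
  refine Finset.sum_congr rfl fun i _ => ?_
  rw [zsmul_eq_mul]
  push_cast
  rfl

theorem coordLie_apply_succ (v : Fin (p + 1) → Coord n) :
    coordLie ξ w y v = fderiv ℝ w y (ξ y) v +
      ∑ i : Fin (p + 1), (-1) ^ (i : ℕ) * w y (Fin.cons (fderiv ℝ ξ y (v i)) (i.removeNth v)) := by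
  rw [coordLie, ContinuousAlternatingMap.fderivCompContinuousLinearMap_eq_alternatizeUncurryFin,
    ContinuousAlternatingMap.add_apply]
  congr 1
  refine (ContinuousAlternatingMap.alternatizeUncurryFin_apply _ _).trans ?_
  refine Finset.sum_congr rfl fun i _ => ?_
  rw [zsmul_eq_mul]
  push_cast
  rfl

end SuccDegree

theorem cartan_formula_zero {w : Coord n → (Coord n) [⋀^Fin 0]→L[ℝ] ℝ} :
    coordLie ξ w y = (extDeriv w y).curryLeft (ξ y) := by
  ext v
  rw [ContinuousAlternatingMap.curryLeft_apply_apply, extDeriv,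
    ContinuousAlternatingMap.alternatizeUncurryFin_apply]
  simp [coordLie]

theorem cartan_formula_succ {w : Coord n → (Coord n) [⋀^Fin (p + 1)]→L[ℝ] ℝ}
    (hξ : DifferentiableAt ℝ ξ y) (hw : DifferentiableAt ℝ w y) :
    coordLie ξ w y = (extDeriv w y).curryLeft (ξ y) +
      extDeriv (fun z => (w z).curryLeft (ξ z)) y := by
  ext v
  rw [ContinuousAlternatingMap.add_apply, ContinuousAlternatingMap.curryLeft_apply_apply,
    coordLie_apply_succ, extDeriv_curryLeft_apply hξ hw]
  refine Eq.trans ?_ (congrArg (· + _) (extDeriv_apply_cons (ξ y) w v).symm)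
  simp only [mul_add, Finset.sum_add_distrib]
  ring

theorem cartan_formula_top {m : ℕ} {ξ : Coord (m + 1) → Coord (m + 1)}
    {w : Coord (m + 1) → (Coord (m + 1)) [⋀^Fin (m + 1)]→L[ℝ] ℝ} {y : Coord (m + 1)}
    (hξ : DifferentiableAt ℝ ξ y) (hw : DifferentiableAt ℝ w y) :
    coordLie ξ w y = extDeriv (fun z => (w z).curryLeft (ξ z)) y := by
  rw [cartan_formula_succ hξ hw, form_eq_zero_of_lt (Nat.lt_succ_self _) (extDeriv w y)]
  exact zero_add _

end LieDerivative

theorem wedge_coordBracket (h : p + q = n) {G : Coord n → Matrix (Fin n) (Fin n) ℝ}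
    {ξ : Coord n → Coord n} {w : Coord n → (Coord n) [⋀^Fin p]→L[ℝ] ℝ} {s : Set (Coord n)}
    (hs : IsOpen s) (hG : ∀ i j, ContDiffOn ℝ ∞ (fun y => G y i j) s)
    (hpos : ∀ y ∈ s, (G y).PosDef) (hw : ContDiffOn ℝ ∞ w s) {y : Coord n} (hy : y ∈ s) :
    wedge h (w y) (coordBracket h G ξ w y) =
      coordLie ξ (fun z => coordInner (G z) (w z) (w z) • volForm (G z)) y -
        (2 * coordInner (G y) (coordLie ξ w y) (w y)) • volForm (G y) := by
  have hdiff : DifferentiableAt ℝ w y :=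
    (hw.contDiffAt (hs.mem_nhds hy)).differentiableAt (by simp)
  have hdiff_star : DifferentiableAt ℝ (fun z => coordStar h (G z) (w z)) y :=
    ((contDiffOn_coordStar hG hpos h hw).contDiffAt (hs.mem_nhds hy)).differentiableAt (by simp)
  have hleibniz := coordLie_wedge h (ξ := ξ) hdiff hdiff_star
  simp only [wedge_coordStar] at hleibniz
  have hsub : wedge h (w y) (coordBracket h G ξ w y) =
      wedge h (w y) (coordLie ξ (fun z => coordStar h (G z) (w z)) y) -
        wedge h (w y) (coordStar h (G y) (coordLie ξ w y)) :=
    map_sub (wedgeₗ h (w y)) _ _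
  have hsymm : (G y).transpose = G y := by
    simpa [Matrix.IsHermitian] using (hpos y hy).isHermitian
  rw [hsub, hleibniz, wedge_coordStar, coordInner_comm hsymm (w y), two_mul, add_smul]
  abel

end Calculus

/-! ### Changes of coordinates on the manifold -/

section Charts

variable {n p : ℕ} {M : Type*} [TopologicalSpace M] [ChartedSpace (Coord n) M] {c c' : M}
  {y : Coord n}

/-- The change of coordinates from the chart at `c` to the chart at `c'`. Outside of the overlap of
the two charts its values are junk. -/
def transition (c c' : M) (y : Coord n) : Coord n :=
  extChartAt (𝓡 n) c' ((extChartAt (𝓡 n) c).symm y)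

theorem extChartAt_symm_transition
    (hy' : (extChartAt (𝓡 n) c).symm y ∈ (extChartAt (𝓡 n) c').source) :
    (extChartAt (𝓡 n) c').symm (transition c c' y) = (extChartAt (𝓡 n) c).symm y :=
  (extChartAt (𝓡 n) c').left_inv hy'

theorem transition_mem_target
    (hy' : (extChartAt (𝓡 n) c).symm y ∈ (extChartAt (𝓡 n) c').source) :
    transition c c' y ∈ (extChartAt (𝓡 n) c').target :=
  (extChartAt (𝓡 n) c').map_source hy'

theorem eventually_mem_overlap (hy : y ∈ (extChartAt (𝓡 n) c).target)
    (hy' : (extChartAt (𝓡 n) c).symm y ∈ (extChartAt (𝓡 n) c').source) :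
    ∀ᶠ z in nhds y, z ∈ (extChartAt (𝓡 n) c).target ∧
      (extChartAt (𝓡 n) c).symm z ∈ (extChartAt (𝓡 n) c').source :=
  have htarget := (isOpen_extChartAt_target c).mem_nhds hy
  Filter.Eventually.and htarget
    (((continuousOn_extChartAt_symm c).continuousAt htarget).preimage_mem_nhds
      ((isOpen_extChartAt_source c').mem_nhds hy'))

theorem injOn_transition {A : Set M} (hc' : A ⊆ (extChartAt (𝓡 n) c').source) :
    Set.InjOn (transition c c')
      ((extChartAt (𝓡 n) c).target ∩ (extChartAt (𝓡 n) c).symm ⁻¹' A) := by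
  rintro y ⟨hy, hyA⟩ z ⟨hz, hzA⟩ h
  have hsymm := congrArg (extChartAt (𝓡 n) c').symm h
  rw [extChartAt_symm_transition (hc' hyA), extChartAt_symm_transition (hc' hzA)] at hsymm
  exact (extChartAt (𝓡 n) c).symm.injOn hy hz hsymm

theorem transition_image_target_inter_preimage {A : Set M}
    (hc : A ⊆ (extChartAt (𝓡 n) c).source) (hc' : A ⊆ (extChartAt (𝓡 n) c').source) :
    transition c c' '' ((extChartAt (𝓡 n) c).target ∩ (extChartAt (𝓡 n) c).symm ⁻¹' A) =
      (extChartAt (𝓡 n) c').target ∩ (extChartAt (𝓡 n) c').symm ⁻¹' A := by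
  ext z
  constructor
  · rintro ⟨y, ⟨-, hyA⟩, rfl⟩
    refine ⟨transition_mem_target (hc' hyA), ?_⟩
    rwa [Set.mem_preimage, extChartAt_symm_transition (hc' hyA)]
  · rintro ⟨hz, hzA⟩
    refine ⟨transition c' c z, ⟨transition_mem_target (hc hzA), ?_⟩, ?_⟩
    · rwa [Set.mem_preimage, extChartAt_symm_transition (hc hzA)]
    · rw [transition, extChartAt_symm_transition (hc hzA)]
      exact (extChartAt (𝓡 n) c').right_inv hz

variable [IsManifold (𝓡 n) ∞ M]

theorem contDiffAt_transition (hy : y ∈ (extChartAt (𝓡 n) c).target)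
    (hy' : (extChartAt (𝓡 n) c).symm y ∈ (extChartAt (𝓡 n) c').source) :
    ContDiffAt ℝ ∞ (transition c c') y := by
  have h := contDiffWithinAt_ext_coord_change (I := 𝓡 n) (n := ∞) c' c (y := y) (by
    rw [PartialEquiv.trans_source]
    exact ⟨hy, hy'⟩)
  rwa [ModelWithCorners.Boundaryless.range_eq_univ, contDiffWithinAt_univ] at h

theorem mdifferentiableAt_extChartAt_symm (hy : y ∈ (extChartAt (𝓡 n) c).target) :
    MDifferentiableAt 𝓘(ℝ, Coord n) (𝓡 n) (extChartAt (𝓡 n) c).symm y :=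
  ((contMDiffOn_extChartAt_symm (n := ∞) c).contMDiffAt
    ((isOpen_extChartAt_target c).mem_nhds hy)).mdifferentiableAt (by simp)

theorem mdifferentiableAt_extChartAt_of_mem {x : M} (hx : x ∈ (extChartAt (𝓡 n) c).source) :
    MDifferentiableAt (𝓡 n) 𝓘(ℝ, Coord n) (extChartAt (𝓡 n) c) x :=
  (contMDiffAt_extChartAt' (n := ∞) (by rwa [extChartAt_source] at hx)).mdifferentiableAt (by simp)

theorem fderiv_transition (hy : y ∈ (extChartAt (𝓡 n) c).target)
    (hy' : (extChartAt (𝓡 n) c).symm y ∈ (extChartAt (𝓡 n) c').source) :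
    fderiv ℝ (transition c c') y =
      (dChart c' ((extChartAt (𝓡 n) c).symm y)).comp (dParam c y) := by
  rw [← mfderiv_eq_fderiv]
  exact mfderiv_comp y (mdifferentiableAt_extChartAt_of_mem hy')
    (mdifferentiableAt_extChartAt_symm hy)

theorem fderiv_transition_comp_fderiv_transition (hy : y ∈ (extChartAt (𝓡 n) c).target)
    (hy' : (extChartAt (𝓡 n) c).symm y ∈ (extChartAt (𝓡 n) c').source) :
    (fderiv ℝ (transition c' c) (transition c c' y)).comp (fderiv ℝ (transition c c') y) =
      ContinuousLinearMap.id ℝ (Coord n) := by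
  have hback : (extChartAt (𝓡 n) c').symm (transition c c' y) ∈ (extChartAt (𝓡 n) c).source := by
    rw [extChartAt_symm_transition hy']
    exact (extChartAt (𝓡 n) c).map_target hy
  have hid : transition c' c ∘ transition c c' =ᶠ[nhds y] id := by
    filter_upwards [eventually_mem_overlap hy hy'] with z ⟨hz, hz'⟩
    exact (congrArg _ (extChartAt_symm_transition hz')).trans ((extChartAt (𝓡 n) c).right_inv hz)
  rw [← fderiv_comp y
    ((contDiffAt_transition (transition_mem_target hy') hback).differentiableAt (by simp))
    ((contDiffAt_transition hy hy').differentiableAt (by simp)), hid.fderiv_eq, fderiv_id]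

theorem det_fderiv_transition_ne_zero (hy : y ∈ (extChartAt (𝓡 n) c).target)
    (hy' : (extChartAt (𝓡 n) c).symm y ∈ (extChartAt (𝓡 n) c').source) :
    (fderiv ℝ (transition c c') y).det ≠ 0 := by
  refine right_ne_zero_of_mul (a := (fderiv ℝ (transition c' c) (transition c c' y)).det) ?_
  rw [ContinuousLinearMap.det, ContinuousLinearMap.det, ← LinearMap.det_comp,
    ← ContinuousLinearMap.toLinearMap_comp, fderiv_transition_comp_fderiv_transition hy hy',
    ContinuousLinearMap.coe_id, LinearMap.det_id]
  exact one_ne_zero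

theorem dChart_comp_dParam (hy : y ∈ (extChartAt (𝓡 n) c).target) :
    (dChart c ((extChartAt (𝓡 n) c).symm y)).comp (dParam c y) =
      ContinuousLinearMap.id ℝ (Coord n) := by
  rw [← fderiv_transition hy ((extChartAt (𝓡 n) c).map_target hy)]
  have hid : transition c c =ᶠ[nhds y] id := by
    filter_upwards [(isOpen_extChartAt_target c).mem_nhds hy] with z hz
    exact (extChartAt (𝓡 n) c).right_inv hz
  rw [hid.fderiv_eq, fderiv_id]

theorem comp_eq_id_comm {A B : Coord n →L[ℝ] Coord n}
    (h : A.comp B = ContinuousLinearMap.id ℝ (Coord n)) :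
    B.comp A = ContinuousLinearMap.id ℝ (Coord n) := by
  have hlin : (A : Coord n →ₗ[ℝ] Coord n) ∘ₗ (B : Coord n →ₗ[ℝ] Coord n) = LinearMap.id :=
    congrArg ContinuousLinearMap.toLinearMap h
  ext1 v
  exact LinearMap.congr_fun ((LinearMap.comp_eq_id_comm ℝ (Coord n)).1 hlin) v

theorem dParam_comp_dChart (hy : y ∈ (extChartAt (𝓡 n) c).target) :
    (dParam c y).comp (dChart c ((extChartAt (𝓡 n) c).symm y)) = ContinuousLinearMap.id ℝ _ :=
  comp_eq_id_comm (dChart_comp_dParam hy)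

theorem dParam_vecInChart (X : VecField n M) (hy : y ∈ (extChartAt (𝓡 n) c).target) :
    dParam c y (vecInChart X c y) = X ((extChartAt (𝓡 n) c).symm y) :=
  DFunLike.congr_fun (dParam_comp_dChart hy) _

/-- The equality `dParam c y = dParam c' (transition c c' y) ∘ D(transition c c')` relates maps
into the tangent spaces at two points that are equal, but not by definition. It is therefore
stated after applying an arbitrary function of the point and the map. -/
theorem dParam_transition (hy : y ∈ (extChartAt (𝓡 n) c).target)
    (hy' : (extChartAt (𝓡 n) c).symm y ∈ (extChartAt (𝓡 n) c').source) {β : Sort*}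
    (f : ∀ x : M, (Coord n →L[ℝ] TangentSpace (𝓡 n) x) → β) :
    f _ (dParam c y) =
      f _ ((dParam c' (transition c c' y)).comp (fderiv ℝ (transition c c') y)) := by
  rw [fderiv_transition hy hy']
  have transport : ∀ (x x' : M) (_ : x' = x) (L : Coord n →L[ℝ] TangentSpace (𝓡 n) x)
      (L' : Coord n →L[ℝ] TangentSpace (𝓡 n) x')
      (_ : L'.comp (dChart c' x') = ContinuousLinearMap.id ℝ _),
      f x L = f x' (L'.comp ((dChart c' x).comp L)) := by
    rintro x _ rfl L L' hL
    rw [← ContinuousLinearMap.comp_assoc, hL, ContinuousLinearMap.id_comp]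
  exact transport _ _ (extChartAt_symm_transition hy') _ _
    (dParam_comp_dChart (transition_mem_target hy'))

theorem formInChart_transition (α : FormField n M p) (hy : y ∈ (extChartAt (𝓡 n) c).target)
    (hy' : (extChartAt (𝓡 n) c).symm y ∈ (extChartAt (𝓡 n) c').source) :
    formInChart α c y = (formInChart α c' (transition c c' y)).compContinuousLinearMap
      (fderiv ℝ (transition c c') y) :=
  dParam_transition hy hy' fun x L => (α x).compContinuousLinearMap L

theorem vecInChart_transition (X : VecField n M) (hy : y ∈ (extChartAt (𝓡 n) c).target)
    (hy' : (extChartAt (𝓡 n) c).symm y ∈ (extChartAt (𝓡 n) c').source) :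
    vecInChart X c' (transition c c' y) = fderiv ℝ (transition c c') y (vecInChart X c y) := by
  rw [fderiv_transition hy hy']
  have transport : ∀ x x' : M, x' = x → dChart c' x' (X x') = dChart c' x (X x) := by
    rintro x _ rfl; rfl
  refine (transport _ _ (extChartAt_symm_transition hy')).trans (congrArg _ ?_)
  exact (dParam_vecInChart X hy).symm

/-! ### The Gram matrix -/

theorem gram_transition (g : Metric n M) (hy : y ∈ (extChartAt (𝓡 n) c).target)
    (hy' : (extChartAt (𝓡 n) c).symm y ∈ (extChartAt (𝓡 n) c').source) :
    gram g c y = (coordMatrix (fderiv ℝ (transition c c') y)).transpose *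
      gram g c' (transition c c' y) * coordMatrix (fderiv ℝ (transition c c') y) := by
  refine (dParam_transition hy hy' fun x L => (Matrix.of fun i j =>
    g.inner x (L (std i)) (L (std j)) : Matrix (Fin n) (Fin n) ℝ)).trans ?_
  ext i j
  simp only [Matrix.of_apply, ContinuousLinearMap.comp_apply, map_std_eq_sum _ i,
    map_std_eq_sum _ j, map_sum, map_smul, sum_apply, smul_apply, Matrix.mul_apply,
    Matrix.transpose_apply, smul_eq_mul, Finset.mul_sum, Finset.sum_mul]
  refine Finset.sum_congr rfl fun k _ => Finset.sum_congr rfl fun l _ => ?_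
  simp only [gram, Matrix.of_apply]
  ring

theorem sqrt_det_gram_transition (g : Metric n M) (hy : y ∈ (extChartAt (𝓡 n) c).target)
    (hy' : (extChartAt (𝓡 n) c).symm y ∈ (extChartAt (𝓡 n) c').source) :
    √(gram g c y).det =
      |(fderiv ℝ (transition c c') y).det| * √(gram g c' (transition c c' y)).det := by
  rw [gram_transition g hy hy', sqrt_det_transpose_mul_mul]

theorem sum_mul_gram (g : Metric n M) (c : M) (y u v : Coord n) :
    ∑ i, ∑ j, u i * gram g c y i j * v j = g.inner _ (dParam c y u) (dParam c y v) := by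
  conv_rhs => rw [← sum_smul_std u, ← sum_smul_std v]
  simp only [map_sum, map_smul, sum_apply, smul_apply, smul_eq_mul, Finset.mul_sum, gram,
    Matrix.of_apply]
  rw [Finset.sum_comm]
  exact Finset.sum_congr rfl fun k _ => Finset.sum_congr rfl fun l _ => by ring

theorem gram_posDef (g : Metric n M) (hy : y ∈ (extChartAt (𝓡 n) c).target) :
    (gram g c y).PosDef := by
  refine Matrix.PosDef.of_dotProduct_mulVec_pos ?_ fun v hv => ?_
  · ext i j
    exact g.symm _ _ _
  · have hquad : star v ⬝ᵥ (gram g c y).mulVec v =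
        g.inner _ (dParam c y (WithLp.toLp 2 v)) (dParam c y (WithLp.toLp 2 v)) := by
      rw [← sum_mul_gram]
      simp [dotProduct, Matrix.mulVec, Finset.mul_sum, mul_assoc]
    rw [hquad]
    refine g.pos _ _ fun h0 => hv ?_
    have hv0 := DFunLike.congr_fun (dChart_comp_dParam hy) (WithLp.toLp 2 v)
    rw [ContinuousLinearMap.comp_apply, h0, map_zero] at hv0
    funext i
    exact (congrArg (fun w : Coord n => w i) hv0).symm

theorem gram_transpose (g : Metric n M) (hy : y ∈ (extChartAt (𝓡 n) c).target) :
    (gram g c y).transpose = gram g c y := by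
  simpa [Matrix.IsHermitian] using (gram_posDef g hy).isHermitian

theorem sqrt_det_gram_pos (g : Metric n M) (hy : y ∈ (extChartAt (𝓡 n) c).target) :
    0 < √(gram g c y).det :=
  Real.sqrt_pos.2 (gram_posDef g hy).det_pos

theorem contMDiffOn_dParam (c : M) (v : Coord n) :
    ContMDiffOn 𝓘(ℝ, Coord n) ((𝓡 n).prod 𝓘(ℝ, Coord n)) ∞
      (fun y => Bundle.TotalSpace.mk' (Coord n) (E := fun x : M => TangentSpace (𝓡 n) x)
        ((extChartAt (𝓡 n) c).symm y) (dParam c y v)) (extChartAt (𝓡 n) c).target := by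
  have htangentMap := (contMDiffOn_extChartAt_symm (I := 𝓡 n) (n := ∞)
    c).contMDiffOn_tangentMapWithin (m := ∞) (by simp) (isOpen_extChartAt_target c).uniqueMDiffOn
  have hconst : ContMDiff 𝓘(ℝ, Coord n) (𝓘(ℝ, Coord n).prod 𝓘(ℝ, Coord n)) ∞
      (fun y => (⟨y, v⟩ : TangentBundle 𝓘(ℝ, Coord n) (Coord n))) :=
    (contMDiff_vectorSpace_iff_contDiff (V := fun _ => v)).2 contDiff_const
  refine (htangentMap.comp hconst.contMDiffOn fun y hy => hy).congr fun y hy => ?_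
  simp only [Function.comp, tangentMapWithin]
  rw [mfderivWithin_of_isOpen (isOpen_extChartAt_target c) hy]
  rfl

theorem contDiffOn_gram (g : Metric n M) (c : M) (i j : Fin n) :
    ContDiffOn ℝ ∞ (fun y => gram g c y i j) (extChartAt (𝓡 n) c).target := by
  intro y hy
  have hinner := ContMDiffWithinAt.clm_bundle_apply₂ (F₁ := Coord n) (F₂ := Coord n)
    (IB := 𝓡 n) (n := ∞) (E₁ := fun x : M => TangentSpace (𝓡 n) x)
    (E₂ := fun x : M => TangentSpace (𝓡 n) x) (E₃ := Bundle.Trivial M ℝ) (F₃ := ℝ)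
    (g.contMDiff.contMDiffAt.comp_contMDiffWithinAt y (contMDiffOn_extChartAt_symm c y hy))
    (contMDiffOn_dParam c (std i) y hy) (contMDiffOn_dParam c (std j) y hy)
  rw [Bundle.contMDiffWithinAt_totalSpace] at hinner
  exact hinner.2.contDiffWithinAt

end Charts

/-! ### Smooth fields and their pointwise inner product -/

section Fields

variable {n p q r : ℕ} {M : Type*} [TopologicalSpace M] [ChartedSpace (Coord n) M]

theorem formInChart_add (α β : FormField n M p) (c : M) (y : Coord n) :
    formInChart (fun x => α x + β x) c y = formInChart α c y + formInChart β c y := rfl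

theorem formInChart_smul (f : M → ℝ) (α : FormField n M p) (c : M) (y : Coord n) :
    formInChart (fun x => f x • α x) c y =
      f ((extChartAt (𝓡 n) c).symm y) • formInChart α c y := rfl

theorem formInChart_wedge (h : p + q = r) (α : FormField n M p) (β : FormField n M q) (c : M)
    (y : Coord n) : formInChart (fun x => wedge h (α x) (β x)) c y =
      wedge h (formInChart α c y) (formInChart β c y) :=
  (wedge_compContinuousLinearMap h _ _ _).symm

theorem IsSmoothForm.add {α β : FormField n M p} (hα : IsSmoothForm α) (hβ : IsSmoothForm β) :
    IsSmoothForm fun x => α x + β x := fun c => (hα c).add (hβ c)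

theorem IsSmoothForm.neg {α : FormField n M p} (hα : IsSmoothForm α) :
    IsSmoothForm fun x => -α x := fun c => (hα c).neg

theorem IsSmoothForm.wedge (h : p + q = r) {α : FormField n M p} {β : FormField n M q}
    (hα : IsSmoothForm α) (hβ : IsSmoothForm β) :
    IsSmoothForm fun x => MorseNovikov.wedge h (α x) (β x) := fun c =>
  (contDiffOn_wedge h (hα c) (hβ c)).congr fun _ _ => formInChart_wedge h _ _ _ _

/-- The field `i_X α` for `α` of positive degree, typed without the truncated subtraction in the
degree of `interiorField X α`. -/
abbrev contraction (X : VecField n M) (α : FormField n M (p + 1)) : FormField n M p :=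
  interiorField X α

variable [IsManifold (𝓡 n) ∞ M]

theorem formInChart_interiorField (X : VecField n M) (α : FormField n M p) {c : M} {y : Coord n}
    (hy : y ∈ (extChartAt (𝓡 n) c).target) :
    formInChart (interiorField X α) c y = interiorProd (vecInChart X c y) (formInChart α c y) := by
  unfold formInChart interiorField
  rw [interiorProd_compContinuousLinearMap, dParam_vecInChart X hy]

theorem formInChart_contraction (X : VecField n M) (α : FormField n M (p + 1)) {c : M}
    {y : Coord n} (hy : y ∈ (extChartAt (𝓡 n) c).target) :
    formInChart (contraction X α) c y = (formInChart α c y).curryLeft (vecInChart X c y) :=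
  formInChart_interiorField X α hy

theorem IsSmoothForm.interiorField {X : VecField n M}
    (hX : ∀ c, ContDiffOn ℝ ∞ (vecInChart X c) (extChartAt (𝓡 n) c).target) {α : FormField n M p}
    (hα : IsSmoothForm α) : IsSmoothForm (interiorField X α) := fun c =>
  (contDiffOn_interiorProd (hX c) (hα c)).congr fun _ hy => formInChart_interiorField X α hy

theorem IsSmoothForm.contraction {X : VecField n M}
    (hX : ∀ c, ContDiffOn ℝ ∞ (vecInChart X c) (extChartAt (𝓡 n) c).target)
    {α : FormField n M (p + 1)} (hα : IsSmoothForm α) : IsSmoothForm (contraction X α) :=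
  hα.interiorField hX

/-- `extDer` is computed at `x` in the chart at `x`; naturality of the exterior derivative under
the change of coordinates makes any other chart as good. -/
theorem formInChart_extDer {α : FormField n M p} (hα : IsSmoothForm α) {c : M} {y : Coord n}
    (hy : y ∈ (extChartAt (𝓡 n) c).target) :
    formInChart (extDer α) c y = extDeriv (formInChart α c) y := by
  set x := (extChartAt (𝓡 n) c).symm y
  have hy' : (extChartAt (𝓡 n) c).symm y ∈ (extChartAt (𝓡 n) x).source := mem_extChartAt_source x
  have hpullback : formInChart α c =ᶠ[nhds y] fun z =>
      (formInChart α x (transition c x z)).compContinuousLinearMap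
        (fderiv ℝ (transition c x) z) := by
    filter_upwards [eventually_mem_overlap hy hy'] with z ⟨hz, hz'⟩
    exact formInChart_transition α hz hz'
  have hdiff : DifferentiableAt ℝ (formInChart α x) (transition c x y) :=
    ((hα x).contDiffAt ((isOpen_extChartAt_target x).mem_nhds
      (transition_mem_target hy'))).differentiableAt (by simp)
  rw [hpullback.extDeriv_eq, extDeriv_pullback (r := ∞) hdiff (contDiffAt_transition hy hy')
    (by rw [minSmoothness_of_isRCLikeNormedField]; exact WithTop.coe_le_coe.2 le_top),
    fderiv_transition hy hy']
  rfl

theorem contDiffOn_extDeriv {w : Coord n → (Coord n) [⋀^Fin p]→L[ℝ] ℝ} {s : Set (Coord n)}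
    (hs : IsOpen s) (hw : ContDiffOn ℝ ∞ w s) : ContDiffOn ℝ ∞ (extDeriv w) s :=
  (ContinuousAlternatingMap.alternatizeUncurryFinCLM ℝ (Coord n) ℝ).contDiff.comp_contDiffOn
    (hw.fderiv_of_isOpen hs (by simp))

theorem IsSmoothForm.extDer {α : FormField n M p} (hα : IsSmoothForm α) :
    IsSmoothForm (extDer α) := fun c =>
  (contDiffOn_extDeriv (isOpen_extChartAt_target c) (hα c)).congr fun _ hy =>
    formInChart_extDer hα hy

theorem IsSmoothForm.dTheta {θ : FormField n M 1} (hθ : IsSmoothForm θ) {α : FormField n M p}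
    (hα : IsSmoothForm α) : IsSmoothForm (dTheta θ α) :=
  hα.extDer.add (hθ.wedge _ hα)

theorem formInner_extChartAt_symm (g : Metric n M) (α β : FormField n M p) {c : M} {y : Coord n}
    (hy : y ∈ (extChartAt (𝓡 n) c).target) :
    formInner g α β ((extChartAt (𝓡 n) c).symm y) =
      coordInner (gram g c y) (formInChart α c y) (formInChart β c y) := by
  have hy' : (extChartAt (𝓡 n) c).symm y ∈
    (extChartAt (𝓡 n) ((extChartAt (𝓡 n) c).symm y)).source := mem_extChartAt_source _
  rw [gram_transition g hy hy', formInChart_transition α hy hy', formInChart_transition β hy hy',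
    coordInner_compContinuousLinearMap _ _ _ (det_fderiv_transition_ne_zero hy hy')]
  rfl

theorem contMDiff_of_contDiffOn_charts {f : M → ℝ}
    (hf : ∀ c : M, ContDiffOn ℝ ∞ (fun y => f ((extChartAt (𝓡 n) c).symm y))
      (extChartAt (𝓡 n) c).target) : ContMDiff (𝓡 n) 𝓘(ℝ, ℝ) ∞ f := fun x =>
  (((hf x).contMDiffOn.comp (contMDiffOn_extChartAt (x := x))
    (by rw [← extChartAt_source (𝓡 n)]; exact (extChartAt (𝓡 n) x).mapsTo)).congr fun z hz =>
      (congrArg f ((extChartAt (𝓡 n) x).left_inv (by rwa [extChartAt_source]))).symm).contMDiffAt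
    (chart_source_mem_nhds _ x)

theorem contMDiff_formInner (g : Metric n M) {α β : FormField n M p} (hα : IsSmoothForm α)
    (hβ : IsSmoothForm β) : ContMDiff (𝓡 n) 𝓘(ℝ, ℝ) ∞ (formInner g α β) :=
  contMDiff_of_contDiffOn_charts fun c =>
    (contDiffOn_coordInner (contDiffOn_gram g c) (fun _ hy => gram_posDef g hy) (hα c)
      (hβ c)).congr fun _ hy => formInner_extChartAt_symm g α β hy

theorem formInner_comm (g : Metric n M) (α β : FormField n M p) (x : M) :
    formInner g α β x = formInner g β α x :=
  coordInner_comm (gram_transpose g (mem_extChartAt_target x)) _ _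

theorem formInner_add_left (g : Metric n M) (α β γ : FormField n M p) (x : M) :
    formInner g (fun x => α x + β x) γ x = formInner g α γ x + formInner g β γ x := by
  unfold formInner
  rw [formInChart_add, coordInner_add_left]

theorem formInner_smul_left (g : Metric n M) (f : M → ℝ) (α β : FormField n M p) (x : M) :
    formInner g (fun x => f x • α x) β x = f x * formInner g α β x := by
  unfold formInner
  rw [formInChart_smul, coordInner_smul_left, extChartAt_to_inv]

theorem formInner_neg_left (g : Metric n M) (α β : FormField n M p) (x : M) :
    formInner g (fun x => -α x) β x = -formInner g α β x := by
  have hneg : (fun x => -α x : FormField n M p) = fun x => (-1 : ℝ) • α x :=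
    funext fun x => (neg_one_smul ℝ (α x)).symm
  rw [hneg, formInner_smul_left g (fun _ => -1), neg_one_mul]

theorem formInner_self_nonneg (g : Metric n M) (α : FormField n M p) (x : M) :
    0 ≤ formInner g α α x :=
  coordInner_self_nonneg (gram_posDef g (mem_extChartAt_target x)) _

theorem formInChart_compContinuousLinearMap_dChart (α : FormField n M p) {c x : M}
    (hx : x ∈ (extChartAt (𝓡 n) c).source) :
    (formInChart α c (extChartAt (𝓡 n) c x)).compContinuousLinearMap (dChart c x) = α x := by
  obtain ⟨y, hy, rfl⟩ := (extChartAt (𝓡 n) c).symm.surjOn hx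
  rw [(extChartAt (𝓡 n) c).right_inv hy]
  ext v
  exact congrArg (α ((extChartAt (𝓡 n) c).symm y))
    (funext fun k => DFunLike.congr_fun (dParam_comp_dChart hy) (v k))

theorem formInner_self_eq_zero (g : Metric n M) {α : FormField n M p} {x : M}
    (h : formInner g α α x = 0) : α x = 0 := by
  rw [← formInChart_compContinuousLinearMap_dChart α (mem_extChartAt_source x),
    coordInner_self_eq_zero (gram_posDef g (mem_extChartAt_target x)) h]
  rfl

end Fields

/-! ### The vector field dual to a one-form -/

section Dual

variable {n p : ℕ} {M : Type*} [TopologicalSpace M] [ChartedSpace (Coord n) M]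
  [IsManifold (𝓡 n) ∞ M] {g : Metric n M} {θ : FormField n M 1} {X : VecField n M}
  (hX : ∀ x v, g.inner x (X x) v = θ x (fun _ => v))

include hX

theorem vecInChart_dual {c : M} {y : Coord n} (hy : y ∈ (extChartAt (𝓡 n) c).target) (j : Fin n) :
    vecInChart X c y j = ∑ i, (gram g c y)⁻¹ i j * formInChart θ c y (fun _ => std i) := by
  have hlower : (fun i => formInChart θ c y (fun _ => std i)) =
      Matrix.vecMul (vecInChart X c y) (gram g c y) := by
    funext i
    have hsum := sum_mul_gram g c y (vecInChart X c y) (std i)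
    rw [dParam_vecInChart X hy, hX] at hsum
    refine hsum.symm.trans ?_
    simp [std_apply, Matrix.vecMul, dotProduct]
  have hdet : IsUnit (gram g c y).det := (gram_posDef g hy).det_pos.ne'.isUnit
  have hraise := congrArg (fun v => Matrix.vecMul v (gram g c y)⁻¹ j) hlower
  simp only [Matrix.vecMul_vecMul, Matrix.mul_nonsing_inv _ hdet, Matrix.vecMul_one] at hraise
  rw [← hraise]
  exact dotProduct_comm _ _

theorem contDiffOn_vecInChart_dual (hθ : IsSmoothForm θ) (c : M) :
    ContDiffOn ℝ ∞ (vecInChart X c) (extChartAt (𝓡 n) c).target := by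
  rw [contDiffOn_euclidean]
  intro j
  refine ContDiffOn.congr (ContDiffOn.sum fun i _ => ?_) fun y hy => vecInChart_dual hX hy j
  exact (contDiffOn_inv_apply (contDiffOn_gram g c) (fun _ hy => gram_posDef g hy) i j).mul
    (contDiffOn_form_iff.1 (hθ c) fun _ => i)

theorem formInner_wedge (η : FormField n M p) (α : FormField n M (p + 1)) (x : M) :
    formInner g (fun x => wedge (Nat.add_comm 1 p) (θ x) (η x)) α x =
      formInner g η (contraction X α) x := by
  have hx := mem_extChartAt_target (I := 𝓡 n) x
  unfold formInner
  rw [formInChart_wedge, formInChart_contraction X α hx,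
    coordInner_wedge_one _ _ _ _ _ (vecInChart_dual hX hx)]

theorem formInner_wedge_self_zero (α : FormField n M 0) (x : M) :
    formInner g (fun x => wedge (Nat.add_comm 1 0) (θ x) (α x))
      (fun x => wedge (Nat.add_comm 1 0) (θ x) (α x)) x =
      g.inner x (X x) (X x) * formInner g α α x := by
  have hcontract : contraction X (fun x => wedge (Nat.add_comm 1 0) (θ x) (α x)) =
      fun x => (θ x fun _ => X x) • α x := funext fun x => interiorProd_wedge_one_zero _ _ _
  rw [formInner_wedge hX, formInner_comm, hX, hcontract, formInner_smul_left]

theorem formInner_wedge_self_succ (α : FormField n M (p + 1)) (x : M) :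
    formInner g (fun x => wedge (Nat.add_comm 1 (p + 1)) (θ x) (α x))
      (fun x => wedge (Nat.add_comm 1 (p + 1)) (θ x) (α x)) x +
      formInner g (contraction X α) (contraction X α) x =
      g.inner x (X x) (X x) * formInner g α α x := by
  have hcontract : contraction X (fun x => wedge (Nat.add_comm 1 (p + 1)) (θ x) (α x)) =
      fun x => (θ x fun _ => X x) • α x +
        -wedge (Nat.add_comm 1 p) (θ x) (contraction X α x) := by
    funext x
    rw [← sub_eq_add_neg]
    exact interiorProd_wedge_one_succ _ _ _
  rw [formInner_wedge hX, formInner_comm, hX, hcontract, formInner_add_left, formInner_smul_left,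
    formInner_neg_left, formInner_wedge hX (contraction X α) α x]
  exact neg_add_cancel_right _ _

end Dual

/-! ### The Riemannian measure -/

section RiemannianMeasure

variable {n : ℕ} {M : Type*} [TopologicalSpace M] [ChartedSpace (Coord n) M]

theorem measurableSet_target_inter_preimage [MeasurableSpace M] [BorelSpace M] (c : M) {A : Set M}
    (hA : MeasurableSet A) :
    MeasurableSet ((extChartAt (𝓡 n) c).target ∩ (extChartAt (𝓡 n) c).symm ⁻¹' A) := by
  have hsymm : Measurable ((extChartAt (𝓡 n) c).target.domRestrict (extChartAt (𝓡 n) c).symm) :=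
    (continuousOn_iff_continuous_domRestrict.1 (continuousOn_extChartAt_symm c)).measurable
  convert (isOpen_extChartAt_target (I := 𝓡 n) c).measurableSet.subtype_image (hsymm hA) using 1
  exact (Subtype.image_preimage_coe _ _).symm

variable (n M) in
theorem exists_measurable_partition_subset_source [MeasurableSpace M] [OpensMeasurableSpace M]
    [LindelofSpace M] [Nonempty M] :
    ∃ (s : ℕ → M) (D : ℕ → Set M), (∀ i, MeasurableSet (D i)) ∧
      Pairwise (Function.onFun Disjoint D) ∧ ⋃ i, D i = Set.univ ∧
      ∀ i, D i ⊆ (extChartAt (𝓡 n) (s i)).source := by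
  obtain ⟨t, htcountable, ht⟩ := LindelofSpace.elim_nhds_subcover
    (fun x : M => (extChartAt (𝓡 n) x).source) fun x => extChartAt_source_mem_nhds x
  have htne : t.Nonempty := by
    rw [Set.nonempty_iff_ne_empty]
    rintro rfl
    rw [Set.biUnion_empty] at ht
    exact Set.empty_ne_univ ht
  obtain ⟨s, rfl⟩ := htcountable.exists_eq_range htne
  refine ⟨s, disjointed fun i => (extChartAt (𝓡 n) (s i)).source,
    MeasurableSet.disjointed fun i => (isOpen_extChartAt_source (s i)).measurableSet,
    disjoint_disjointed _, ?_, disjointed_subset _⟩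
  rw [iUnion_disjointed, ← ht, Set.biUnion_range]

variable [IsManifold (𝓡 n) ∞ M] (g : Metric n M)

theorem continuousOn_sqrt_det_gram (c : M) :
    ContinuousOn (fun y => √(gram g c y).det) (extChartAt (𝓡 n) c).target :=
  (contDiffOn_sqrt_det (contDiffOn_gram g c) fun _ hy => gram_posDef g hy).continuousOn

theorem aemeasurable_ofReal_sqrt_det_gram (c : M) :
    AEMeasurable (fun y => ENNReal.ofReal √(gram g c y).det)
      (volume.restrict (extChartAt (𝓡 n) c).target) :=
  ((continuousOn_sqrt_det_gram g c).aemeasurable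
    (isOpen_extChartAt_target c).measurableSet).ennreal_ofReal

variable [MeasurableSpace M] [BorelSpace M]

theorem aemeasurable_extChartAt_symm (c : M) :
    AEMeasurable (extChartAt (𝓡 n) c).symm
      (((volume : Measure (Coord n)).restrict (extChartAt (𝓡 n) c).target).withDensity
        fun y => ENNReal.ofReal √(gram g c y).det) :=
  ((continuousOn_extChartAt_symm c).aemeasurable
    (isOpen_extChartAt_target c).measurableSet).mono_ac (withDensity_absolutelyContinuous _ _)

theorem chartVolume_apply (c : M) {A : Set M} (hA : MeasurableSet A) :
    chartVolume g c A =
      ∫⁻ y in (extChartAt (𝓡 n) c).target ∩ (extChartAt (𝓡 n) c).symm ⁻¹' A,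
        ENNReal.ofReal √(gram g c y).det := by
  rw [chartVolume, Measure.map_apply_of_aemeasurable (aemeasurable_extChartAt_symm g c) hA,
    withDensity_apply', Measure.restrict_restrict' (isOpen_extChartAt_target c).measurableSet,
    Set.inter_comm]

theorem chartVolume_inter_source (c : M) {A : Set M} (hA : MeasurableSet A) :
    chartVolume g c (A ∩ (extChartAt (𝓡 n) c).source) = chartVolume g c A := by
  rw [chartVolume_apply g c hA,
    chartVolume_apply g c (hA.inter (isOpen_extChartAt_source c).measurableSet)]
  congr 2
  ext y
  exact ⟨fun ⟨hy, hyA, _⟩ => ⟨hy, hyA⟩,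
    fun ⟨hy, hyA⟩ => ⟨hy, hyA, (extChartAt (𝓡 n) c).map_target hy⟩⟩

theorem chartVolume_eq_of_subset {c c' : M} {A : Set M} (hA : MeasurableSet A)
    (hc : A ⊆ (extChartAt (𝓡 n) c).source) (hc' : A ⊆ (extChartAt (𝓡 n) c').source) :
    chartVolume g c A = chartVolume g c' A := by
  have hmeas := measurableSet_target_inter_preimage (n := n) c hA
  rw [chartVolume_apply g c hA, chartVolume_apply g c' hA,
    ← transition_image_target_inter_preimage (n := n) hc hc',
    lintegral_image_eq_lintegral_abs_det_fderiv_mul volume hmeas (fun y hy =>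
      ((contDiffAt_transition hy.1 (hc' hy.2)).differentiableAt
        (by simp)).hasFDerivAt.hasFDerivWithinAt) (injOn_transition (n := n) hc')]
  refine setLIntegral_congr_fun hmeas fun y hy => ?_
  rw [sqrt_det_gram_transition g hy.1 (hc' hy.2), ENNReal.ofReal_mul (abs_nonneg _)]

theorem exists_measure_eq_chartVolume [LindelofSpace M] [Nonempty M] :
    ∃ ν : Measure M, ∀ (c : M) (A : Set M), MeasurableSet A →
      A ⊆ (extChartAt (𝓡 n) c).source → ν A = chartVolume g c A := by
  obtain ⟨s, D, hDmeas, hDdisj, hDunion, hDsource⟩ :=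
    exists_measurable_partition_subset_source n M
  refine ⟨Measure.sum fun i => (chartVolume g (s i)).restrict (D i), fun c A hA hc => ?_⟩
  have hpiece (i : ℕ) : (chartVolume g (s i)).restrict (D i) A = chartVolume g c (A ∩ D i) := by
    rw [Measure.restrict_apply hA]
    exact chartVolume_eq_of_subset g (hA.inter (hDmeas i))
      (Set.inter_subset_right.trans (hDsource i)) (Set.inter_subset_left.trans hc)
  have hdisj : Pairwise (Function.onFun Disjoint fun i => A ∩ D i) := fun i j hij =>
    (hDdisj hij).mono Set.inter_subset_right Set.inter_subset_right
  rw [Measure.sum_apply _ hA]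
  simp only [hpiece]
  rw [← measure_iUnion hdisj fun i => hA.inter (hDmeas i), ← Set.inter_iUnion, hDunion,
    Set.inter_univ]

theorem riemVolume_apply [LindelofSpace M] {c : M} {A : Set M} (hA : MeasurableSet A)
    (hc : A ⊆ (extChartAt (𝓡 n) c).source) : riemVolume g A = chartVolume g c A := by
  have : Nonempty M := ⟨c⟩
  obtain ⟨ν, hν⟩ := exists_measure_eq_chartVolume g
  have hle : riemVolume g ≤ ν := iSup_le fun c' => Measure.le_iff.2 fun B hB => by
    rw [← chartVolume_inter_source g c' hB, ← hν c' _
      (hB.inter (isOpen_extChartAt_source c').measurableSet) Set.inter_subset_right]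
    exact measure_mono Set.inter_subset_left
  refine le_antisymm ?_ (le_iSup (chartVolume g) c A)
  rw [← hν c A hA hc]
  exact hle A

theorem riemVolume_restrict_source [LindelofSpace M] (c : M) :
    (riemVolume g).restrict (extChartAt (𝓡 n) c).source = chartVolume g c := by
  ext A hA
  rw [Measure.restrict_apply hA, riemVolume_apply g
    (hA.inter (isOpen_extChartAt_source c).measurableSet) Set.inter_subset_right,
    chartVolume_inter_source g c hA]

instance isLocallyFiniteMeasure_riemVolume [LindelofSpace M] :
    IsLocallyFiniteMeasure (riemVolume g) := by
  refine ⟨fun x => ?_⟩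
  set y₀ := extChartAt (𝓡 n) x x
  have htarget := (isOpen_extChartAt_target x).mem_nhds (mem_extChartAt_target (I := 𝓡 n) x)
  obtain ⟨r, hr, hball⟩ := Metric.eventually_nhds_iff_ball.1
    (((continuousOn_sqrt_det_gram g x).continuousAt htarget).eventually_lt_const (lt_add_one _))
  set U := (extChartAt (𝓡 n) x).source ∩ extChartAt (𝓡 n) x ⁻¹' Metric.ball y₀ r
  have hU : IsOpen U := (continuousOn_extChartAt x).isOpen_inter_preimage
    (isOpen_extChartAt_source x) Metric.isOpen_ball
  refine ⟨U, hU.mem_nhds ⟨mem_extChartAt_source x, Metric.mem_ball_self hr⟩, ?_⟩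
  have hsub : (extChartAt (𝓡 n) x).target ∩ (extChartAt (𝓡 n) x).symm ⁻¹' U ⊆
      Metric.ball y₀ r := by
    rintro y ⟨hy, -, hyr⟩
    rwa [Set.mem_preimage, (extChartAt (𝓡 n) x).right_inv hy] at hyr
  rw [riemVolume_apply g (c := x) hU.measurableSet Set.inter_subset_left,
    chartVolume_apply g x hU.measurableSet]
  calc _ ≤ ∫⁻ y in Metric.ball y₀ r, ENNReal.ofReal √(gram g x y).det := lintegral_mono_set hsub
    _ ≤ ∫⁻ _ in Metric.ball y₀ r, ENNReal.ofReal (√(gram g x y₀).det + 1) :=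
        setLIntegral_mono' measurableSet_ball fun y hy =>
          ENNReal.ofReal_le_ofReal (hball y hy).le
    _ < ⊤ := by
        rw [setLIntegral_const]
        exact ENNReal.mul_lt_top ENNReal.ofReal_lt_top measure_ball_lt_top

theorem chartVolume_pos {U : Set M} (hU : IsOpen U) {x : M} (hx : x ∈ U) :
    0 < chartVolume g x U := by
  have hopen : IsOpen ((extChartAt (𝓡 n) x).target ∩ (extChartAt (𝓡 n) x).symm ⁻¹' U) :=
    (continuousOn_extChartAt_symm x).isOpen_inter_preimage (isOpen_extChartAt_target x) hU
  have hne : ((extChartAt (𝓡 n) x).target ∩ (extChartAt (𝓡 n) x).symm ⁻¹' U).Nonempty :=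
    ⟨extChartAt (𝓡 n) x x, mem_extChartAt_target x, by
      rwa [Set.mem_preimage, extChartAt_to_inv]⟩
  rw [chartVolume_apply g x hU.measurableSet, pos_iff_ne_zero]
  intro h
  rw [lintegral_eq_zero_iff' ((aemeasurable_ofReal_sqrt_det_gram g x).mono_set
    Set.inter_subset_left)] at h
  have hae : ∀ᵐ y ∂volume,
      y ∉ (extChartAt (𝓡 n) x).target ∩ (extChartAt (𝓡 n) x).symm ⁻¹' U := by
    filter_upwards [(ae_restrict_iff' hopen.measurableSet).1 h] with y hy hmem
    exact (ENNReal.ofReal_pos.2 (sqrt_det_gram_pos g hmem.1)).ne' (hy hmem)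
  exact (hopen.measure_pos volume hne).ne' (measure_eq_zero_iff_ae_notMem.2 hae)

instance isOpenPosMeasure_riemVolume [LindelofSpace M] :
    (riemVolume g).IsOpenPosMeasure :=
  ⟨fun _ hU ⟨x, hx⟩ => ((chartVolume_pos g hU hx).trans_le (le_iSup (chartVolume g) x _)).ne'⟩

theorem integrable_of_continuous [CompactSpace M] {f : M → ℝ} (hf : Continuous f) :
    Integrable f (riemVolume g) :=
  hf.integrable_of_hasCompactSupport (HasCompactSupport.of_compactSpace f)

theorem setIntegral_source [LindelofSpace M] (c : M) {f : M → ℝ} (hf : Continuous f) :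
    ∫ x in (extChartAt (𝓡 n) c).source, f x ∂(riemVolume g) =
      ∫ y in (extChartAt (𝓡 n) c).target,
        √(gram g c y).det * f ((extChartAt (𝓡 n) c).symm y) := by
  rw [riemVolume_restrict_source, chartVolume, integral_map (aemeasurable_extChartAt_symm g c)
    hf.aestronglyMeasurable, integral_withDensity_eq_integral_toReal_smul₀
    (aemeasurable_ofReal_sqrt_det_gram g c)
    (Filter.Eventually.of_forall fun _ => ENNReal.ofReal_lt_top)]
  simp only [ENNReal.toReal_ofReal (Real.sqrt_nonneg _), smul_eq_mul]

end RiemannianMeasure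

/-! ### The divergence theorem -/

section DivergenceInCoordinates

variable {m : ℕ}

theorem integral_fderiv_apply_eq_zero {E : Type*} [NormedAddCommGroup E] [NormedSpace ℝ E]
    [FiniteDimensional ℝ E] [MeasurableSpace E] [BorelSpace E] (μ : Measure E)
    [μ.IsAddHaarMeasure] {f : E → ℝ} (hf : ContDiff ℝ 1 f) (hsupp : HasCompactSupport f) (e : E) :
    ∫ y, fderiv ℝ f y e ∂μ = 0 := by
  have hint : Integrable (fun y => fderiv ℝ f y e) μ :=
    ((hf.continuous_fderiv (by simp)).clm_apply
      continuous_const).integrable_of_hasCompactSupport (hsupp.fderiv_apply ℝ e)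
  simpa using integral_mul_fderiv_eq_neg_fderiv_mul_of_integrable (μ := μ) (𝕜 := ℝ)
    (f := fun _ => (1 : ℝ)) (g := f) (v := e) (by simp) (by simpa using hint)
    (by simpa using hf.continuous.integrable_of_hasCompactSupport hsupp)
    (fun _ _ => differentiableAt_const _) (fun _ _ => hf.differentiable (by simp) _)

theorem integral_extDeriv_eq_zero {W : Coord (m + 1) → (Coord (m + 1)) [⋀^Fin m]→L[ℝ] ℝ}
    (hW : ContDiff ℝ 1 W) (hsupp : HasCompactSupport W) :
    ∫ y, extDeriv W y std = 0 := by
  have hW_apply (v : Fin m → Coord (m + 1)) : ContDiff ℝ 1 fun y => W y v :=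
    (ContinuousAlternatingMap.apply ℝ (Coord (m + 1)) ℝ v).contDiff.comp hW
  have hsupp_apply (v : Fin m → Coord (m + 1)) : HasCompactSupport fun y => W y v :=
    hsupp.comp_left (g := fun w : (Coord (m + 1)) [⋀^Fin m]→L[ℝ] ℝ => w v) rfl
  simp only [extDeriv_apply (hW.differentiable (by simp) _), zsmul_eq_mul]
  rw [integral_finsetSum]
  · refine Finset.sum_eq_zero fun i _ => ?_
    rw [integral_const_mul, integral_fderiv_apply_eq_zero volume (hW_apply _) (hsupp_apply _),
      mul_zero]
  · exact fun i _ => ((((hW_apply _).continuous_fderiv (by simp)).clm_apply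
      continuous_const).integrable_of_hasCompactSupport
        ((hsupp_apply _).fderiv_apply ℝ _)).const_mul _

theorem extDeriv_eq_zero_of_notMem_tsupport {n p : ℕ} {w : Coord n → (Coord n) [⋀^Fin p]→L[ℝ] ℝ}
    {y : Coord n} (hy : y ∉ tsupport w) : extDeriv w y = 0 := by
  rw [extDeriv, fderiv_of_notMem_tsupport ℝ hy]
  exact map_zero (ContinuousAlternatingMap.alternatizeUncurryFinCLM ℝ (Coord n) ℝ)

theorem setIntegral_extDeriv_eq_zero {W : Coord (m + 1) → (Coord (m + 1)) [⋀^Fin m]→L[ℝ] ℝ}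
    {U K : Set (Coord (m + 1))} (hU : IsOpen U) (hW : ContDiffOn ℝ 1 W U) (hK : IsCompact K)
    (hKU : K ⊆ U) (hzero : ∀ y ∈ U, y ∉ K → W y = 0) :
    ∫ y in U, extDeriv W y std = 0 := by
  have hzero_off : ∀ y, y ∉ K → U.indicator W y = 0 := fun y hy => by
    by_cases hyU : y ∈ U
    · rw [Set.indicator_of_mem hyU, hzero y hyU hy]
    · exact Set.indicator_of_notMem hyU W
  have hsupp : tsupport (U.indicator W) ⊆ U :=
    (closure_minimal (fun y hy => not_imp_comm.1 (hzero_off y) hy) hK.isClosed).trans hKU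
  have hlocal : ∀ y ∈ U, U.indicator W =ᶠ[nhds y] W := fun y hy =>
    Filter.eventuallyEq_of_mem (hU.mem_nhds hy) fun _ hz => Set.indicator_of_mem hz W
  have hsmooth : ContDiff ℝ 1 (U.indicator W) :=
    (contMDiff_of_tsupport fun y hy => ((hW.contDiffAt (hU.mem_nhds
      (hsupp hy))).congr_of_eventuallyEq (hlocal y (hsupp hy))).contMDiffAt).contDiff
  calc ∫ y in U, extDeriv W y std
      = ∫ y in U, extDeriv (U.indicator W) y std :=
        setIntegral_congr_fun hU.measurableSet fun y hy => by
          rw [(hlocal y hy).extDeriv_eq]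
    _ = ∫ y, extDeriv (U.indicator W) y std :=
        setIntegral_eq_integral_of_forall_compl_eq_zero fun y hy => by
          rw [extDeriv_eq_zero_of_notMem_tsupport fun h => hy (hsupp h),
            ContinuousAlternatingMap.coe_zero, Pi.zero_apply]
    _ = 0 := integral_extDeriv_eq_zero hsmooth (HasCompactSupport.intro hK hzero_off)

theorem eventually_abs_eq_sign_mul {Y : Type*} [TopologicalSpace Y] {f : Y → ℝ} {y : Y}
    (hf : ContinuousAt f y) (hy : f y ≠ 0) :
    ∀ᶠ z in nhds y, |f z| = (SignType.sign (f y) : ℝ) * f z := by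
  have hsign : ContinuousAt (fun z => SignType.sign (f z)) y :=
    (continuousAt_sign_of_ne_zero hy).comp hf
  filter_upwards [hsign.eventually_mem (isOpen_discrete {SignType.sign (f y)} |>.mem_nhds rfl)]
    with z hz
  rw [← sign_mul_self, Set.mem_singleton_iff.1 hz]

end DivergenceInCoordinates

theorem exists_finite_smoothPartitionOfUnity (n : ℕ) (M : Type*) [TopologicalSpace M]
    [T2Space M] [CompactSpace M] [ChartedSpace (Coord n) M] [IsManifold (𝓡 n) ∞ M] :
    ∃ (t : Finset M) (ρ : SmoothPartitionOfUnity t (𝓡 n) M),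
      ρ.IsSubordinate fun i => (extChartAt (𝓡 n) (i : M)).source := by
  obtain ⟨t, ht⟩ := CompactSpace.elim_nhds_subcover
    (fun x : M => (extChartAt (𝓡 n) x).source) fun x => extChartAt_source_mem_nhds x
  refine ⟨t, SmoothPartitionOfUnity.exists_isSubordinate _ isClosed_univ _
    (fun i => isOpen_extChartAt_source _) ?_⟩
  exact ht.symm.le.trans_eq (Set.biUnion_eq_iUnion _ _)

section Divergence

variable {m : ℕ} {M : Type*} [TopologicalSpace M] [ChartedSpace (Coord (m + 1)) M]
  [IsManifold (𝓡 (m + 1)) ∞ M]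

/-- The form `i_X (u dV)` in the chart at `c`, where `dV` is taken for the orientation of the
coordinates. -/
def fluxForm (g : Metric (m + 1) M) (X : VecField (m + 1) M) (u : M → ℝ) (c : M)
    (y : Coord (m + 1)) : (Coord (m + 1)) [⋀^Fin m]→L[ℝ] ℝ :=
  (u ((extChartAt (𝓡 (m + 1)) c).symm y) • volForm (gram g c y)).curryLeft (vecInChart X c y)

/-- The divergence of `u X`, that is, the function `f` with `d (i_X (u dV)) = f dV`. It is computed
at `x` in the chart at `x`. -/
def divergence (g : Metric (m + 1) M) (X : VecField (m + 1) M) (u : M → ℝ) (x : M) : ℝ :=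
  coordDensity (gram g x (extChartAt (𝓡 (m + 1)) x x))
    (extDeriv (fluxForm g X u x) (extChartAt (𝓡 (m + 1)) x x))

variable {g : Metric (m + 1) M} {X : VecField (m + 1) M} {u : M → ℝ} {c c' : M}
  {y : Coord (m + 1)}

theorem fluxForm_transition {s : ℝ} (hy : y ∈ (extChartAt (𝓡 (m + 1)) c).target)
    (hy' : (extChartAt (𝓡 (m + 1)) c).symm y ∈ (extChartAt (𝓡 (m + 1)) c').source)
    (hs : |(fderiv ℝ (transition c c') y).det| = s * (fderiv ℝ (transition c c') y).det) :
    fluxForm g X u c y = s • (fluxForm g X u c' (transition c c' y)).compContinuousLinearMap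
      (fderiv ℝ (transition c c') y) := by
  have hvol : volForm (gram g c y) = (s * (fderiv ℝ (transition c c') y).det) •
      volForm (gram g c' (transition c c' y)) := by
    rw [volForm, volForm, sqrt_det_gram_transition g hy hy', hs, smul_smul]
  rw [fluxForm, fluxForm, vecInChart_transition X hy hy', extChartAt_symm_transition hy',
    ← ContinuousAlternatingMap.curryLeft_compContinuousLinearMap,
    top_form_compContinuousLinearMap, hvol]
  ext v
  simp only [ContinuousAlternatingMap.curryLeft_apply_apply, ContinuousAlternatingMap.smul_apply,
    smul_eq_mul]
  ring

theorem divergence_eq_zero_of_notMem_tsupport {x : M} (hx : x ∉ tsupport u) :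
    divergence g X u x = 0 := by
  rw [notMem_tsupport_iff_eventuallyEq] at hx
  have hflux : fluxForm g X u x =ᶠ[nhds (extChartAt (𝓡 (m + 1)) x x)] 0 := by
    have hu : ∀ᶠ z in nhds ((extChartAt (𝓡 (m + 1)) x).symm (extChartAt (𝓡 (m + 1)) x x)),
        u z = 0 := by rwa [extChartAt_to_inv]
    filter_upwards [(continuousAt_extChartAt_symm x).eventually hu] with y hy
    rw [fluxForm, hy, zero_smul, ContinuousAlternatingMap.curryLeft_zero]
    rfl
  rw [divergence, extDeriv_eq_zero_of_notMem_tsupport (notMem_tsupport_iff_eventuallyEq.2 hflux),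
    coordDensity, ContinuousAlternatingMap.coe_zero, Pi.zero_apply, zero_div]

variable (hX : ∀ c, ContDiffOn ℝ ∞ (vecInChart X c) (extChartAt (𝓡 (m + 1)) c).target)
  (hu : ContMDiff (𝓡 (m + 1)) 𝓘(ℝ, ℝ) ∞ u)

include hX hu

theorem contDiffOn_fluxForm (c : M) :
    ContDiffOn ℝ ∞ (fluxForm g X u c) (extChartAt (𝓡 (m + 1)) c).target :=
  contDiffOn_interiorProd (hX c)
    ((hu.comp_contMDiffOn (contMDiffOn_extChartAt_symm c)).contDiffOn.smul
      (contDiffOn_volForm (contDiffOn_gram g c) fun _ hy => gram_posDef g hy))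

theorem differentiableAt_fluxForm (hy : y ∈ (extChartAt (𝓡 (m + 1)) c).target) :
    DifferentiableAt ℝ (fluxForm g X u c) y :=
  ((contDiffOn_fluxForm hX hu c).contDiffAt
    ((isOpen_extChartAt_target c).mem_nhds hy)).differentiableAt (by simp)

theorem extDeriv_fluxForm_transition (hy : y ∈ (extChartAt (𝓡 (m + 1)) c).target)
    (hy' : (extChartAt (𝓡 (m + 1)) c).symm y ∈ (extChartAt (𝓡 (m + 1)) c').source) :
    extDeriv (fluxForm g X u c) y = |(fderiv ℝ (transition c c') y).det| •
      extDeriv (fluxForm g X u c') (transition c c' y) := by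
  have hdet : ContinuousAt (fun z => (fderiv ℝ (transition c c') z).det) y :=
    ContinuousLinearMap.continuous_det.continuousAt.comp
      ((contDiffAt_transition hy hy').fderiv_right (m := 0) (by simp)).continuousAt
  have hsign := eventually_abs_eq_sign_mul hdet (det_fderiv_transition_ne_zero hy hy')
  have hflux : fluxForm g X u c =ᶠ[nhds y]
      (SignType.sign (fderiv ℝ (transition c c') y).det : ℝ) • fun z =>
        (fluxForm g X u c' (transition c c' z)).compContinuousLinearMap
          (fderiv ℝ (transition c c') z) := by
    filter_upwards [eventually_mem_overlap hy hy', hsign] with z hz hsz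
    exact fluxForm_transition hz.1 hz.2 hsz
  rw [hflux.extDeriv_eq, extDeriv_smul, extDeriv_pullback (r := ∞)
    (differentiableAt_fluxForm hX hu (transition_mem_target hy')) (contDiffAt_transition hy hy')
    (by rw [minSmoothness_of_isRCLikeNormedField]; exact WithTop.coe_le_coe.2 le_top),
    top_form_compContinuousLinearMap, smul_smul, hsign.self_of_nhds]

theorem divergence_extChartAt_symm (hy : y ∈ (extChartAt (𝓡 (m + 1)) c).target) :
    divergence g X u ((extChartAt (𝓡 (m + 1)) c).symm y) =
      coordDensity (gram g c y) (extDeriv (fluxForm g X u c) y) := by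
  have hy' : (extChartAt (𝓡 (m + 1)) c).symm y ∈
      (extChartAt (𝓡 (m + 1)) ((extChartAt (𝓡 (m + 1)) c).symm y)).source :=
    mem_extChartAt_source _
  rw [coordDensity, extDeriv_fluxForm_transition hX hu hy hy', sqrt_det_gram_transition g hy hy',
    ContinuousAlternatingMap.smul_apply, smul_eq_mul,
    mul_div_mul_left _ _ (abs_ne_zero.2 (det_fderiv_transition_ne_zero hy hy'))]
  rfl

theorem contMDiff_divergence : ContMDiff (𝓡 (m + 1)) 𝓘(ℝ, ℝ) ∞ (divergence g X u) := by
  refine contMDiff_of_contDiffOn_charts fun c => ?_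
  have hext := contDiffOn_form_iff.1 (contDiffOn_extDeriv (isOpen_extChartAt_target c)
    (contDiffOn_fluxForm (g := g) hX hu c)) id
  exact (hext.div (contDiffOn_sqrt_det (contDiffOn_gram g c) fun _ hy => gram_posDef g hy)
    fun y hy => (sqrt_det_gram_pos g hy).ne').congr fun y hy => divergence_extChartAt_symm hX hu hy

omit hu in
theorem divergence_sum {ι : Type*} (s : Finset ι) {v : ι → M → ℝ}
    (hv : ∀ i, ContMDiff (𝓡 (m + 1)) 𝓘(ℝ, ℝ) ∞ (v i)) (x : M) :
    divergence g X (fun x => ∑ i ∈ s, v i x) x = ∑ i ∈ s, divergence g X (v i) x := by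
  have hflux : fluxForm g X (fun x => ∑ i ∈ s, v i x) x =
      fun y => ∑ i ∈ s, fluxForm g X (v i) x y := by
    funext y
    ext w
    simp only [fluxForm, ContinuousAlternatingMap.curryLeft_apply_apply,
      ContinuousAlternatingMap.sum_apply, ContinuousAlternatingMap.smul_apply, smul_eq_mul,
      Finset.sum_mul]
  have hext : extDeriv (fluxForm g X (fun x => ∑ i ∈ s, v i x) x) (extChartAt (𝓡 (m + 1)) x x) =
      ∑ i ∈ s, extDeriv (fluxForm g X (v i) x) (extChartAt (𝓡 (m + 1)) x x) := by
    rw [hflux, extDeriv, fderiv_fun_sum fun i _ =>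
      differentiableAt_fluxForm hX (hv i) (mem_extChartAt_target x)]
    exact map_sum (ContinuousAlternatingMap.alternatizeUncurryFinCLM ℝ (Coord (m + 1)) ℝ) _ _
  simp only [divergence, hext, coordDensity, ContinuousAlternatingMap.sum_apply, Finset.sum_div]

variable [CompactSpace M] [MeasurableSpace M] [BorelSpace M]

theorem integral_divergence_eq_zero_of_tsupport_subset
    (hc : tsupport u ⊆ (extChartAt (𝓡 (m + 1)) c).source) :
    ∫ x, divergence g X u x ∂(riemVolume g) = 0 := by
  have hcompact : IsCompact (extChartAt (𝓡 (m + 1)) c '' tsupport u) :=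
    (isClosed_tsupport u).isCompact.image_of_continuousOn ((continuousOn_extChartAt c).mono hc)
  have hzero : ∀ y ∈ (extChartAt (𝓡 (m + 1)) c).target,
      y ∉ extChartAt (𝓡 (m + 1)) c '' tsupport u → fluxForm g X u c y = 0 := fun y hy hyu => by
    have hsymm : (extChartAt (𝓡 (m + 1)) c).symm y ∉ tsupport u := fun h =>
      hyu ⟨_, h, (extChartAt (𝓡 (m + 1)) c).right_inv hy⟩
    rw [fluxForm, image_eq_zero_of_notMem_tsupport hsymm, zero_smul,
      ContinuousAlternatingMap.curryLeft_zero]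
    rfl
  rw [← setIntegral_eq_integral_of_forall_compl_eq_zero
      (s := (extChartAt (𝓡 (m + 1)) c).source) fun x hx =>
        divergence_eq_zero_of_notMem_tsupport fun h => hx (hc h),
    setIntegral_source g c (contMDiff_divergence hX hu).continuous,
    ← setIntegral_extDeriv_eq_zero (isOpen_extChartAt_target c)
      ((contDiffOn_fluxForm (g := g) hX hu c).of_le (by simp)) hcompact
      ((Set.image_mono hc).trans_eq (extChartAt (𝓡 (m + 1)) c).image_source_eq_target) hzero]
  refine setIntegral_congr_fun (isOpen_extChartAt_target c).measurableSet fun y hy => ?_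
  rw [divergence_extChartAt_symm hX hu hy, coordDensity,
    mul_div_cancel₀ _ (sqrt_det_gram_pos g hy).ne']

theorem integral_divergence_eq_zero [T2Space M] :
    ∫ x, divergence g X u x ∂(riemVolume g) = 0 := by
  obtain ⟨t, ρ, hρ⟩ := exists_finite_smoothPartitionOfUnity (m + 1) M
  have hρu (i : t) : ContMDiff (𝓡 (m + 1)) 𝓘(ℝ, ℝ) ∞ fun x => ρ i x * u x :=
    (ρ i).contMDiff.mul hu
  have hsum : (fun x => ∑ i, ρ i x * u x) = u := by
    funext x
    rw [← Finset.sum_mul, ← finsum_eq_sum_of_fintype, ρ.sum_eq_one (Set.mem_univ x), one_mul]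
  have hdiv (x : M) : divergence g X u x = ∑ i, divergence g X (fun x => ρ i x * u x) x := by
    rw [← divergence_sum hX _ hρu, hsum]
  simp only [hdiv]
  rw [integral_finsetSum _ fun i _ =>
    integrable_of_continuous g (contMDiff_divergence hX (hρu i)).continuous]
  exact Finset.sum_eq_zero fun i _ => integral_divergence_eq_zero_of_tsupport_subset hX (hρu i)
    ((closure_mono (Function.support_mul_subset_left _ _)).trans (hρ i))

end Divergence

/-! ### The Lie derivative and its bracket with the Hodge star -/

section LieDerivativeOfFields

variable {n p : ℕ} {M : Type*} [TopologicalSpace M] [ChartedSpace (Coord n) M]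

/-- The Lie derivative `L_X α`, computed at `x` in the chart at `x`. -/
def lieDer (X : VecField n M) (α : FormField n M p) : FormField n M p := fun x =>
  (coordLie (vecInChart X x) (formInChart α x) (extChartAt (𝓡 n) x x)).compContinuousLinearMap
    (dChart x x)

variable [IsManifold (𝓡 n) ∞ M] {X : VecField n M}

theorem surjective_dChart {c x : M} (hx : x ∈ (extChartAt (𝓡 n) c).source) :
    Function.Surjective (dChart (n := n) c x) := by
  obtain ⟨y, hy, rfl⟩ := (extChartAt (𝓡 n) c).symm.surjOn hx
  exact fun v => ⟨dParam c y v, DFunLike.congr_fun (dChart_comp_dParam hy) v⟩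

theorem formInChart_lieDer (X : VecField n M) (α : FormField n M p) (x : M) :
    formInChart (lieDer X α) x (extChartAt (𝓡 n) x x) =
      coordLie (vecInChart X x) (formInChart α x) (extChartAt (𝓡 n) x x) := by
  have hx := mem_extChartAt_source (I := 𝓡 n) x
  ext v
  obtain ⟨u, rfl⟩ := (surjective_dChart hx).comp_left v
  exact DFunLike.congr_fun (formInChart_compContinuousLinearMap_dChart (lieDer X α) hx) u

theorem lieDer_eq_of_formInChart_eq {α β : FormField n M p}
    (h : ∀ x, coordLie (vecInChart X x) (formInChart α x) (extChartAt (𝓡 n) x x) =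
      formInChart β x (extChartAt (𝓡 n) x x)) : lieDer X α = β :=
  funext fun x => by
    rw [lieDer, h x, formInChart_compContinuousLinearMap_dChart β (mem_extChartAt_source x)]

theorem lieDer_zero (X : VecField n M) {α : FormField n M 0} (hα : IsSmoothForm α) :
    lieDer X α = contraction X (extDer α) :=
  lieDer_eq_of_formInChart_eq fun x => by
    have hx := mem_extChartAt_target (I := 𝓡 n) x
    rw [cartan_formula_zero, ← formInChart_extDer hα hx, formInChart_contraction X _ hx]

theorem lieDer_succ (hX : ∀ c, ContDiffOn ℝ ∞ (vecInChart X c) (extChartAt (𝓡 n) c).target)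
    {α : FormField n M (p + 1)} (hα : IsSmoothForm α) :
    lieDer X α = fun x => contraction X (extDer α) x + extDer (contraction X α) x :=
  lieDer_eq_of_formInChart_eq fun x => by
    have hx := mem_extChartAt_target (I := 𝓡 n) x
    have hnhds := (isOpen_extChartAt_target (I := 𝓡 n) x).mem_nhds hx
    have hinterior : (fun z => (formInChart α x z).curryLeft (vecInChart X x z))
        =ᶠ[nhds (extChartAt (𝓡 n) x x)] formInChart (contraction X α) x := by
      filter_upwards [hnhds] with z hz
      exact (formInChart_contraction X α hz).symm
    rw [cartan_formula_succ (((hX x).contDiffAt hnhds).differentiableAt (by simp))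
      (((hα x).contDiffAt hnhds).differentiableAt (by simp)), hinterior.extDeriv_eq,
      ← formInChart_extDer hα hx, ← formInChart_extDer (hα.contraction hX) hx, formInChart_add,
      formInChart_contraction X _ hx]

theorem IsSmoothForm.lieDer
    (hX : ∀ c, ContDiffOn ℝ ∞ (vecInChart X c) (extChartAt (𝓡 n) c).target)
    {α : FormField n M p} (hα : IsSmoothForm α) : IsSmoothForm (lieDer X α) := by
  cases p with
  | zero =>
    rw [lieDer_zero X hα]
    exact hα.extDer.contraction hX
  | succ p =>
    rw [lieDer_succ hX hα]
    exact (hα.extDer.contraction hX).add (hα.contraction hX).extDer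

end LieDerivativeOfFields

section Bracket

theorem coordDensity_smul_volForm {n : ℕ} {G : Matrix (Fin n) (Fin n) ℝ} (hG : √G.det ≠ 0)
    (r : ℝ) : coordDensity G (r • volForm G) = r := by
  simp [coordDensity, volForm, coordVol_std, hG]

/-- The Leibniz rule for `L_X (α ∧ *α)`, divided by `dV`. -/
theorem wedgeBracketDensity_eq {m p q : ℕ} {M : Type*} [TopologicalSpace M]
    [ChartedSpace (Coord (m + 1)) M] [IsManifold (𝓡 (m + 1)) ∞ M] (g : Metric (m + 1) M)
    {X : VecField (m + 1) M}
    (hX : ∀ c, ContDiffOn ℝ ∞ (vecInChart X c) (extChartAt (𝓡 (m + 1)) c).target)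
    (h : p + q = m + 1) {α : FormField (m + 1) M p} (hα : IsSmoothForm α) (x : M) :
    wedgeBracketDensity g X h α x =
      divergence g X (formInner g α α) x - 2 * formInner g (lieDer X α) α x := by
  have hx := mem_extChartAt_target (I := 𝓡 (m + 1)) x
  have hopen := isOpen_extChartAt_target (I := 𝓡 (m + 1)) x
  have hpos : ∀ y ∈ (extChartAt (𝓡 (m + 1)) x).target, (gram g x y).PosDef :=
    fun _ hy => gram_posDef g hy
  have hnormVol : ContDiffOn ℝ ∞ (fun y => coordInner (gram g x y) (formInChart α x y)
      (formInChart α x y) • volForm (gram g x y)) (extChartAt (𝓡 (m + 1)) x).target :=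
    (contDiffOn_coordInner (contDiffOn_gram g x) hpos (hα x) (hα x)).smul
      (contDiffOn_volForm (contDiffOn_gram g x) hpos)
  have hflux : (fun y => (coordInner (gram g x y) (formInChart α x y) (formInChart α x y) •
      volForm (gram g x y)).curryLeft (vecInChart X x y))
      =ᶠ[nhds (extChartAt (𝓡 (m + 1)) x x)] fluxForm g X (formInner g α α) x := by
    filter_upwards [hopen.mem_nhds hx] with y hy
    rw [fluxForm, formInner_extChartAt_symm g α α hy]
  have hlie : coordLie (vecInChart X x) (fun y => coordInner (gram g x y) (formInChart α x y)
      (formInChart α x y) • volForm (gram g x y)) (extChartAt (𝓡 (m + 1)) x x) =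
      extDeriv (fluxForm g X (formInner g α α) x) (extChartAt (𝓡 (m + 1)) x x) := by
    rw [cartan_formula_top (((hX x).contDiffAt (hopen.mem_nhds hx)).differentiableAt (by simp))
      ((hnormVol.contDiffAt (hopen.mem_nhds hx)).differentiableAt (by simp)), hflux.extDeriv_eq]
  calc wedgeBracketDensity g X h α x
      = coordDensity (gram g x (extChartAt (𝓡 (m + 1)) x x))
          (extDeriv (fluxForm g X (formInner g α α) x) (extChartAt (𝓡 (m + 1)) x x) -
            (2 * formInner g (lieDer X α) α x) •
              volForm (gram g x (extChartAt (𝓡 (m + 1)) x x))) := by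
        rw [wedgeBracketDensity, wedge_coordBracket h hopen (contDiffOn_gram g x) hpos (hα x) hx,
          hlie, formInner, formInChart_lieDer]
    _ = divergence g X (formInner g α α) x -
          coordDensity (gram g x (extChartAt (𝓡 (m + 1)) x x))
            ((2 * formInner g (lieDer X α) α x) •
              volForm (gram g x (extChartAt (𝓡 (m + 1)) x x))) :=
        sub_div _ _ _
    _ = _ := by rw [coordDensity_smul_volForm (sqrt_det_gram_pos g hx).ne']

variable {n p q : ℕ} {M : Type*} [TopologicalSpace M] [ChartedSpace (Coord n) M]
  [IsManifold (𝓡 n) ∞ M]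

theorem wedgeBracketDensity_of_subsingleton [Subsingleton (Coord n)] (g : Metric n M)
    (X : VecField n M) (h : p + q = n) (α : FormField n M p) (x : M) :
    wedgeBracketDensity g X h α x = 0 := by
  have hstar : coordStar h (gram g x (extChartAt (𝓡 n) x x))
      (0 : (Coord n) [⋀^Fin p]→L[ℝ] ℝ) = 0 := by
    simp [coordStar]
  have hwedge : wedge h (formInChart α x (extChartAt (𝓡 n) x x)) 0 = 0 :=
    map_zero (wedgeₗ h (formInChart α x (extChartAt (𝓡 n) x x)))
  rw [wedgeBracketDensity, coordBracket, coordLie_of_subsingleton, coordLie_of_subsingleton, hstar,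
    sub_zero, hwedge]
  exact zero_div _

variable [MeasurableSpace M] [BorelSpace M] [CompactSpace M] [T2Space M]

theorem integral_wedgeBracketDensity (g : Metric n M) {X : VecField n M}
    (hX : ∀ c, ContDiffOn ℝ ∞ (vecInChart X c) (extChartAt (𝓡 n) c).target)
    (h : p + q = n) {α : FormField n M p} (hα : IsSmoothForm α) :
    ∫ x, wedgeBracketDensity g X h α x ∂(riemVolume g) = -2 * l2Inner g (lieDer X α) α := by
  cases n with
  | zero =>
    have hinner (x : M) : formInner g (lieDer X α) α x = 0 := by
      rw [formInner, formInChart_lieDer, coordLie_of_subsingleton]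
      simp [coordInner]
    simp only [wedgeBracketDensity_of_subsingleton, l2Inner, hinner, integral_zero, mul_zero]
  | succ m =>
    have hnorm := contMDiff_formInner g hα hα
    simp only [wedgeBracketDensity_eq g hX h hα]
    rw [integral_sub (integrable_of_continuous g (contMDiff_divergence hX hnorm).continuous)
      ((integrable_of_continuous g
        (contMDiff_formInner g (hα.lieDer hX) hα).continuous).const_mul 2),
      integral_divergence_eq_zero hX hnorm, integral_const_mul, zero_sub, neg_mul]
    rfl

end Bracket

/-! ### Harmonic forms -/

section InnerProduct

variable {n p : ℕ} {M : Type*} [TopologicalSpace M] [ChartedSpace (Coord n) M]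
  [IsManifold (𝓡 n) ∞ M] [MeasurableSpace M] (g : Metric n M)

theorem l2Inner_comm (α β : FormField n M p) : l2Inner g α β = l2Inner g β α := by
  simp only [l2Inner, formInner_comm g α β]

theorem l2Inner_self_nonneg (α : FormField n M p) : 0 ≤ l2Inner g α α :=
  integral_nonneg fun x => formInner_self_nonneg g α x

theorem l2Inner_neg_left (α β : FormField n M p) :
    l2Inner g (fun x => -α x) β = -l2Inner g α β := by
  simp only [l2Inner, formInner_neg_left, integral_neg]

theorem l2Inner_zero_left (β : FormField n M p) : l2Inner g (fun _ => 0) β = 0 := by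
  have hneg := l2Inner_neg_left g (fun _ => 0) β
  simp only [neg_zero] at hneg
  exact self_eq_neg.1 hneg

theorem l2Inner_wedge {g : Metric n M} {θ : FormField n M 1} {X : VecField n M}
    (hX : ∀ x v, g.inner x (X x) v = θ x (fun _ => v)) (η : FormField n M p)
    (α : FormField n M (p + 1)) :
    l2Inner g (fun x => wedge (Nat.add_comm 1 p) (θ x) (η x)) α =
      l2Inner g η (contraction X α) := by
  simp only [l2Inner, formInner_wedge hX]

variable [BorelSpace M] [CompactSpace M]

theorem l2Inner_add_left {α β γ : FormField n M p} (hα : IsSmoothForm α) (hβ : IsSmoothForm β)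
    (hγ : IsSmoothForm γ) :
    l2Inner g (fun x => α x + β x) γ = l2Inner g α γ + l2Inner g β γ := by
  simp only [l2Inner, formInner_add_left]
  exact integral_add (integrable_of_continuous g (contMDiff_formInner g hα hγ).continuous)
    (integrable_of_continuous g (contMDiff_formInner g hβ hγ).continuous)

theorem eq_zero_of_l2Inner_self {α : FormField n M p} (hα : IsSmoothForm α)
    (h : l2Inner g α α = 0) (x : M) : α x = 0 := by
  have hcont := (contMDiff_formInner g hα hα).continuous
  have hae : formInner g α α =ᵐ[riemVolume g] 0 := (integral_eq_zero_iff_of_nonneg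
    (fun x => formInner_self_nonneg g α x) (integrable_of_continuous g hcont)).1 h
  exact formInner_self_eq_zero g
    (congrFun ((hcont.ae_eq_iff_eq (riemVolume g) continuous_zero).1 hae) x)

end InnerProduct

namespace IsThetaHarmonic

variable {n p q : ℕ} {M : Type*} [TopologicalSpace M] [ChartedSpace (Coord n) M]
  [IsManifold (𝓡 n) ∞ M] [MeasurableSpace M] [BorelSpace M] [CompactSpace M] {g : Metric n M}
  {θ : FormField n M 1}

theorem dTheta_eq_zero_and_isAdjointValue_zero (hθ : IsSmoothForm θ)
    {α : FormField n M (p + 1)} (hα : IsSmoothForm α) (h : IsThetaHarmonic g θ α) :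
    (∀ x, dTheta θ α x = 0) ∧ IsAdjointValue g (dTheta θ) α fun _ => 0 := by
  obtain ⟨β, γ, hβ, hγ, hsum⟩ := h
  have hβ_sq : l2Inner g (dTheta θ β) α = l2Inner g β β := hβ.2 β hβ.1
  have hγ_sq : l2Inner g (dTheta θ α) (dTheta θ α) = l2Inner g α γ := hγ.2 α hα
  have hlaplacian := l2Inner_add_left g (hθ.dTheta hβ.1) hγ.1 hα
  rw [funext hsum, l2Inner_zero_left, hβ_sq, l2Inner_comm g γ, ← hγ_sq] at hlaplacian
  have hβ_nonneg := l2Inner_self_nonneg g β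
  have hα_nonneg := l2Inner_self_nonneg g (dTheta θ α)
  have hβ_zero : β = fun _ => 0 := funext (eq_zero_of_l2Inner_self g hβ.1 (by linarith))
  exact ⟨eq_zero_of_l2Inner_self g (hθ.dTheta hα) (by linarith), hβ_zero ▸ hβ⟩

theorem dTheta_eq_zero (hθ : IsSmoothForm θ) {α : FormField n M p} (hα : IsSmoothForm α)
    (h : IsThetaHarmonic g θ α) (x : M) : dTheta θ α x = 0 := by
  cases p with
  | zero =>
    refine eq_zero_of_l2Inner_self g (hθ.dTheta hα) ?_ x
    rw [h.2 α hα, l2Inner_comm]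
    exact l2Inner_zero_left g α
  | succ p => exact (h.dTheta_eq_zero_and_isAdjointValue_zero hθ hα).1 x

theorem extDer_eq (hθ : IsSmoothForm θ) {α : FormField n M p} (hα : IsSmoothForm α)
    (h : IsThetaHarmonic g θ α) :
    extDer α = fun x => -wedge (Nat.add_comm 1 p) (θ x) (α x) :=
  funext fun x => eq_neg_of_add_eq_zero_left (h.dTheta_eq_zero hθ hα x)

variable {X : VecField n M} (hX : ∀ x v, g.inner x (X x) v = θ x (fun _ => v))

include hX

theorem l2Inner_extDer (hθ : IsSmoothForm θ) {α : FormField n M (p + 1)} (hα : IsSmoothForm α)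
    (h : IsThetaHarmonic g θ α) {η : FormField n M p} (hη : IsSmoothForm η) :
    l2Inner g (extDer η) α = -l2Inner g η (contraction X α) := by
  have horth : l2Inner g (dTheta θ η) α = 0 := by
    rw [(h.dTheta_eq_zero_and_isAdjointValue_zero hθ hα).2.2 η hη, l2Inner_comm, l2Inner_zero_left]
  unfold dTheta at horth
  rw [l2Inner_add_left g hη.extDer (hθ.wedge _ hη) hα, l2Inner_wedge hX] at horth
  exact eq_neg_of_add_eq_zero_left horth

theorem isCodifferential (hθ : IsSmoothForm θ) {α : FormField n M p} (hα : IsSmoothForm α)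
    (h : IsThetaHarmonic g θ α) : IsCodifferential g α fun x => -interiorField X α x := by
  cases p with
  | zero => exact funext fun x => neg_zero (G := (TangentSpace (𝓡 n) x) [⋀^Fin (0 - 1)]→L[ℝ] ℝ)
  | succ p =>
    refine ⟨(hα.interiorField (contDiffOn_vecInChart_dual hX hθ)).neg, fun η hη => ?_⟩
    rw [h.l2Inner_extDer hX hθ hα hη, l2Inner_comm g η, l2Inner_comm g η, l2Inner_neg_left]

theorem l2Inner_contraction_extDer (hθ : IsSmoothForm θ) {α : FormField n M p}
    (hα : IsSmoothForm α) (h : IsThetaHarmonic g θ α) :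
    l2Inner g (contraction X (extDer α)) α =
      -l2Inner g (fun x => wedge (Nat.add_comm 1 p) (θ x) (α x))
        fun x => wedge (Nat.add_comm 1 p) (θ x) (α x) := by
  rw [l2Inner_comm, ← l2Inner_wedge hX, h.extDer_eq hθ hα, l2Inner_comm, l2Inner_neg_left]

theorem l2Inner_lieDer (hθ : IsSmoothForm θ) {α : FormField n M p} (hα : IsSmoothForm α)
    (h : IsThetaHarmonic g θ α) :
    l2Inner g (lieDer X α) α =
      -∫ x, g.inner x (X x) (X x) * formInner g α α x ∂(riemVolume g) := by
  have hwedge := h.l2Inner_contraction_extDer hX hθ hα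
  cases p with
  | zero =>
    rw [lieDer_zero X hα, hwedge]
    simp only [← formInner_wedge_self_zero hX]
    rfl
  | succ p =>
    have hXs := contDiffOn_vecInChart_dual hX hθ
    have hXα : IsSmoothForm (contraction X α) := hα.contraction hXs
    have hθα : IsSmoothForm fun x => wedge (Nat.add_comm 1 (p + 1)) (θ x) (α x) := hθ.wedge _ hα
    rw [lieDer_succ hXs hα, l2Inner_add_left g (hα.extDer.contraction hXs) hXα.extDer hα,
      hwedge, h.l2Inner_extDer hX hθ hα hXα, ← neg_add]
    simp only [← formInner_wedge_self_succ hX]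
    rw [integral_add (integrable_of_continuous g (contMDiff_formInner g hθα hθα).continuous)
      (integrable_of_continuous g (contMDiff_formInner g hXα hXα).continuous)]
    rfl

theorem integral_eq [T2Space M] (hpq : p + q = n) (hθ : IsSmoothForm θ) {α : FormField n M p}
    (hα : IsSmoothForm α) (h : IsThetaHarmonic g θ α) :
    ∫ x, g.inner x (X x) (X x) * formInner g α α x ∂(riemVolume g) =
      (1 / 2) * ∫ x, wedgeBracketDensity g X hpq α x ∂(riemVolume g) := by
  rw [integral_wedgeBracketDensity g (contDiffOn_vecInChart_dual hX hθ) hpq hα,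
    h.l2Inner_lieDer hX hθ hα]
  ring

end IsThetaHarmonic

end MorseNovikov

end

theorem theorem4p1_general {n p q : ℕ} (hpq : p + q = n)
    {M : Type*} [TopologicalSpace M] [T2Space M] [CompactSpace M]
    [ChartedSpace (Coord n) M] [IsManifold (𝓡 n) ∞ M]
    [MeasurableSpace M] [BorelSpace M]
    (g : MorseNovikov.Metric n M)
    (θ : FormField n M 1) (hθ : IsSmoothForm θ)
    (X : VecField n M) (hX : ∀ x v, g.inner x (X x) v = θ x (fun _ => v))
    (α : FormField n M p) (hα : IsSmoothForm α) (hharm : IsThetaHarmonic g θ α) :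
    (∀ x, extDer α x + wedge (Nat.add_comm 1 p) (θ x) (α x) = 0) ∧
    (∃ δ : FormField n M (p - 1), IsCodifferential g α δ ∧ ∀ x, δ x + interiorField X α x = 0) ∧
    ∫ x, g.inner x (X x) (X x) * formInner g α α x ∂(riemVolume g) =
      (1 / 2) * ∫ x, wedgeBracketDensity g X hpq α x ∂(riemVolume g) := by
  refine ⟨fun x => hharm.dTheta_eq_zero hθ hα x, ⟨_, hharm.isCodifferential hX hθ hα, fun x => ?_⟩,
    hharm.integral_eq hX hpq hθ hα⟩
  exact neg_add_cancel (G := (TangentSpace (𝓡 n) x) [⋀^Fin (p - 1)]→L[ℝ] ℝ) _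

theorem theorem4p1 {n p q : ℕ} (hpq : p + q = n)
    {M : Type*} [TopologicalSpace M] [T2Space M] [CompactSpace M]
    [ChartedSpace (Coord n) M] [IsManifold (𝓡 n) ∞ M]
    [MeasurableSpace M] [BorelSpace M]
    (g : MorseNovikov.Metric n M)
    (θ : FormField n M 1) (hθ : IsSmoothForm θ) (hclosed : ∀ x, extDer θ x = 0)
    (X : VecField n M) (hX : ∀ x v, g.inner x (X x) v = θ x (fun _ => v))
    (α : FormField n M p) (hα : IsSmoothForm α) (hharm : IsThetaHarmonic g θ α) :
    (∀ x, extDer α x + wedge (Nat.add_comm 1 p) (θ x) (α x) = 0) ∧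
    (∃ δ : FormField n M (p - 1), IsCodifferential g α δ ∧ ∀ x, δ x + interiorField X α x = 0) ∧
    ∫ x, g.inner x (X x) (X x) * formInner g α α x ∂(riemVolume g) =
      (1 / 2) * ∫ x, wedgeBracketDensity g X hpq α x ∂(riemVolume g) :=
  theorem4p1_general hpq g θ hθ X hX α hα hharm
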